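/- **Setting.** A time grid is a set $\mathbb T=\{t_0,t_1,\dots\}$ with $0=t_0<t_1<\cdots$ and $t_n\to\infty$. Fix grids $\mathbb T_1\subset\mathbb T_2\subset\cdots$ with $\lim_N\sup_{t_i\in\mathbb T_N}|t_{i+1}-t_i|=0$. A path $X:[0,\infty)\to\mathbb R$ has continuous quadratic variation $[X]$ along $(\mathbb T_N)$ if for each $t>0$ the limit $$[X]_t=\lim_{N\to\infty}\sum_{t_i,t_{i+1}\in\mathbb T_N,\ t_{i+1}\le t}(X_{t_{i+1}}-X_{t_i})^2$$ exists and $t\mapsto[X]_t$, with $[X]_0=0$, is continuous on $[0,\infty)$. Let $S:[0,\infty)\to(0,\infty)$ be continuous with continuous quadratic variation along $(\mathbb T_N)$, let $r:[0,\infty)\to\mathbb R$ be measurable with $\int_0^t|r_s|\,ds<\infty$ for all $t>0$, and put $B_t=\exp\big(\int_0^tr_s\,ds\big)$. A function $\xi$ is an admissible integrand for $S$ if for each $T>0$ there are $n\in\mathbb N$, $g\in C^1(\mathbb R^{n+1})$ and a continuous $A:[0,\infty)\to\mathbb R^n$ with components of finite variation on $[0,T]$ such that $\xi_t=g(A_t,S_t)$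 for $0\le t\le T$. The pathwise Itô integral is $$\int_0^t\xi_s\,dS_s=\lim_{N\to\infty}\sum_{t_i,t_{i+1}\in\mathbb T_N,\ t_{i+1}\le t}\xi_{t_i}(S_{t_{i+1}}-S_{t_i}).$$ A pair $(\xi,\eta)$ of measurable functions on $[0,\infty)$ such that $\xi$ is an admissible integrand for $S$ and $\int_0^t|\eta_sr_s|\,ds<\infty$ for all $t\ge0$ is a self-financing strategy if its portfolio value $V_t=\xi_tS_t+\eta_tB_t$ satisfies $$V_t=V_0+\int_0^t\xi_s\,dS_s+\int_0^t\eta_s\,dB_s\qquad\text{for all }t\ge0,$$ where the last integral is a Lebesgue–Stieltjes integral. **Theorem.** Let $V_0\ge0$, $\alpha\in[0,1]$ and $m>0$. Then $\log S$ has continuous quadratic variation $[\log S]$ along $(\mathbb T_N)$. Define $$C_t=(1-\alpha)V_0\Big(\frac{S_t}{S_0}\Big)^mB_t^{1-m}e^{-\frac12m(m-1)[\log S]_t},\qquad V_t=C_t+\alpha V_0B_t,$$ $$\xi_t=\frac{mC_t}{S_t},\qquad \eta_t=\frac{V_t-\xi_tS_t}{B_t}=\frac{V_t-mC_t}{B_t}.$$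 Then $(\xi,\eta)$ is a self-financing strategy with portfolio value $V$, and $$V_t\ge\alpha V_0B_t\qquad\text{for all }t\ge0.$$ Moreover, $(\xi,\eta)$ is the unique self-financing strategy with initial value $V_0$ that follows the CPPI rules: if $(\tilde\xi,\tilde\eta)$ is a self-financing strategy whose portfolio value $\tilde V$ satisfies $\tilde V_0=V_0$, and if, with $\tilde C_t=\tilde V_t-\alpha V_0B_t$, one has $\tilde\xi_t=m\tilde C_t/S_t$ and $\tilde\eta_t=(\tilde V_t-\tilde\xi_tS_t)/B_t=(\tilde V_t-m\tilde C_t)/B_t$ for all $t\ge0$, then $\tilde\xi_t=\xi_t$ and $\tilde\eta_t=\eta_t$ for all $t\ge0$. -/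

import Mathlib

/-! Functions of time `t ∈ [0, ∞)` are modelled by functions `ℝ → ℝ` of which only the values on
`[0, ∞)` matter. -/

open Set Filter Topology MeasureTheory

noncomputable section

namespace PathwiseCPPI

/-- A time grid `𝕋 = {t₀, t₁, …}` with `0 = t₀ < t₁ < ⋯` and `tₙ → ∞`. -/
structure TimeGrid where
  pt : ℕ → ℝ
  pt_zero : pt 0 = 0
  strictMono : StrictMono pt
  tendsto_atTop : Tendsto pt atTop atTop

namespace TimeGrid

/-- The underlying set of time points of a grid. -/
def points (G : TimeGrid) : Set ℝ := range G.pt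

/-- The mesh `sup_i |t_{i+1} - t_i|`, possibly infinite. -/
def mesh (G : TimeGrid) : ENNReal := ⨆ i, ENNReal.ofReal |G.pt (i + 1) - G.pt i|

theorem finite_le (G : TimeGrid) (t : ℝ) : {i : ℕ | G.pt (i + 1) ≤ t}.Finite := by
  obtain ⟨n, hn⟩ := (G.tendsto_atTop.eventually_gt_atTop t).exists
  refine (finite_lt_nat n).subset fun i hi => ?_
  exact lt_of_lt_of_le (Nat.lt_succ_self i) (G.strictMono.lt_iff_lt.1 (lt_of_le_of_lt hi hn)).le

/-- The (finitely many) indices `i` with `t_{i+1} ≤ t`. -/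
def indices (G : TimeGrid) (t : ℝ) : Finset ℕ := (G.finite_le t).toFinset

theorem mem_indices {G : TimeGrid} {t : ℝ} {i : ℕ} : i ∈ G.indices t ↔ G.pt (i + 1) ≤ t := by
  simp [indices]

end TimeGrid

/-- A sequence of time grids `𝕋₀ ⊆ 𝕋₁ ⊆ ⋯` whose mesh tends to zero. -/
structure RefiningGrids where
  grid : ℕ → TimeGrid
  nested : ∀ N, (grid N).points ⊆ (grid (N + 1)).points
  mesh_tendsto : Tendsto (fun N => (grid N).mesh) atTop (𝓝 0)

/-- The sums `∑ (X_{t_{i+1}} - X_{t_i})²` over `t_i, t_{i+1} ∈ 𝕋_N` with `t_{i+1} ≤ t`. -/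
def quadVarSum (P : RefiningGrids) (X : ℝ → ℝ) (t : ℝ) (N : ℕ) : ℝ :=
  ∑ i ∈ (P.grid N).indices t, (X ((P.grid N).pt (i + 1)) - X ((P.grid N).pt i)) ^ 2

/-- The pathwise quadratic variation `[X]_t`, the limit of the sums of squared increments. It is
meaningful when the limit exists; for `t = 0` all sums are empty and `[X]_0 = 0`. -/
def quadVar (P : RefiningGrids) (X : ℝ → ℝ) (t : ℝ) : ℝ :=
  limUnder atTop (quadVarSum P X t)

/-- `X` has continuous quadratic variation along the grids: for each `t > 0` the limit defining
`[X]_t` exists, and `t ↦ [X]_t` is continuous on `[0, ∞)`. -/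
def HasContinuousQuadVar (P : RefiningGrids) (X : ℝ → ℝ) : Prop :=
  (∀ t, 0 < t → ∃ q, Tendsto (quadVarSum P X t) atTop (𝓝 q)) ∧
    ContinuousOn (quadVar P X) (Ici 0)

/-- `ξ` is an admissible integrand for `X`: for each `T > 0` it is of the form
`ξ_t = g(A_t, X_t)` on `[0, T]`, with `g` a `C¹` function on `ℝⁿ × ℝ` and `A` a continuous `ℝⁿ`-valued
function with components of finite variation on `[0, T]`. -/
def IsAdmissibleIntegrand (X ξ : ℝ → ℝ) : Prop :=
  ∀ T : ℝ, 0 < T → ∃ (n : ℕ) (g : (Fin n → ℝ) × ℝ → ℝ) (A : ℝ → Fin n → ℝ),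
    ContDiff ℝ 1 g ∧ ContinuousOn A (Ici 0) ∧
    (∀ k, BoundedVariationOn (fun t => A t k) (Icc 0 T)) ∧
    ∀ t ∈ Icc 0 T, ξ t = g (A t, X t)

/-- The pathwise Itô integral `∫₀ᵗ ξ dX` exists, as the limit of the nonanticipative Riemann sums
`∑ ξ_{t_i} (X_{t_{i+1}} - X_{t_i})` over `t_i, t_{i+1} ∈ 𝕋_N` with `t_{i+1} ≤ t`, and equals `I`. -/
def HasItoIntegral (P : RefiningGrids) (ξ X : ℝ → ℝ) (t I : ℝ) : Prop :=
  Tendsto (fun N => ∑ i ∈ (P.grid N).indices t,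
    ξ ((P.grid N).pt i) * (X ((P.grid N).pt (i + 1)) - X ((P.grid N).pt i))) atTop (𝓝 I)

/-- The path `F` on `[0, t]`, extended to `ℝ` by its values at the two endpoints. -/
def stopped (F : ℝ → ℝ) (t : ℝ) : ℝ → ℝ := fun s => F (max 0 (min s t))

/-- The Lebesgue–Stieltjes integral `∫₀ᵗ η dF` exists (`F` has finite variation on `[0, t]`, and
`η` is integrable for the associated signed Stieltjes measure) and equals `J`. -/
def HasStieltjesIntegral (η F : ℝ → ℝ) (t J : ℝ) : Prop :=
  ∃ hF : BoundedVariationOn (stopped F t) univ,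
    hF.vectorMeasure.IntegrableOn η (Ioc 0 t) ∧
    ∫ᵛ s in Ioc 0 t, η s ∂•hF.vectorMeasure = J

/-- The bond price `B_t = exp(∫₀ᵗ r_s ds)`. -/
def bond (r : ℝ → ℝ) (t : ℝ) : ℝ := Real.exp (∫ s in (0 : ℝ)..t, r s)

/-- The portfolio value `V_t = ξ_t S_t + η_t B_t`. -/
def portfolioValue (r S ξ η : ℝ → ℝ) (t : ℝ) : ℝ := ξ t * S t + η t * bond r t

/-- `(ξ, η)` is a self-financing strategy for the stock `S` and the bond with short rate `r`. -/
structure IsSelfFinancing (P : RefiningGrids) (r S ξ η : ℝ → ℝ) : Prop where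
  measurable_stock : Measurable fun t : Ici (0 : ℝ) => ξ t
  measurable_bond : Measurable fun t : Ici (0 : ℝ) => η t
  admissible : IsAdmissibleIntegrand S ξ
  integrable : ∀ t, 0 ≤ t → IntegrableOn (fun s => η s * r s) (Icc 0 t)
  value_eq : ∀ t, 0 ≤ t → ∃ I J,
    HasItoIntegral P ξ S t I ∧ HasStieltjesIntegral η (bond r) t J ∧
    portfolioValue r S ξ η t = portfolioValue r S ξ η 0 + I + J

/-- The strategy `(ξ, η)` has initial value `V₀` and obeys the CPPI rules: with
`V_t = ξ_t S_t + η_t B_t` its portfolio value and `C_t = V_t - α V₀ B_t` its cushion, one has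
`ξ_t = m C_t / S_t` and `η_t = (V_t - ξ_t S_t) / B_t = (V_t - m C_t) / B_t` for all `t ≥ 0`. -/
structure FollowsCPPI (r S : ℝ → ℝ) (V₀ α m : ℝ) (ξ η : ℝ → ℝ) : Prop where
  initial : portfolioValue r S ξ η 0 = V₀
  stock_eq : ∀ t, 0 ≤ t →
    ξ t = m * (portfolioValue r S ξ η t - α * V₀ * bond r t) / S t
  bond_eq : ∀ t, 0 ≤ t →
    η t = (portfolioValue r S ξ η t - ξ t * S t) / bond r t
  bond_eq' : ∀ t, 0 ≤ t →
    η t = (portfolioValue r S ξ η t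
      - m * (portfolioValue r S ξ η t - α * V₀ * bond r t)) / bond r t

/-- The cushion
`C_t = (1 - α) V₀ (S_t / S_0)^m B_t^(1 - m) exp(-½ m (m - 1) [log S]_t)`. -/
def cppiCushion (P : RefiningGrids) (r S : ℝ → ℝ) (V₀ α m : ℝ) (t : ℝ) : ℝ :=
  (1 - α) * V₀ * (S t / S 0) ^ m * bond r t ^ (1 - m) *
    Real.exp (-(1 / 2) * m * (m - 1) * quadVar P (fun s => Real.log (S s)) t)

/-- The value `V_t = C_t + α V₀ B_t`. -/
def cppiValue (P : RefiningGrids) (r S : ℝ → ℝ) (V₀ α m : ℝ) (t : ℝ) : ℝ :=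
  cppiCushion P r S V₀ α m t + α * V₀ * bond r t

/-- The number of shares `ξ_t = m C_t / S_t`. -/
def cppiStock (P : RefiningGrids) (r S : ℝ → ℝ) (V₀ α m : ℝ) (t : ℝ) : ℝ :=
  m * cppiCushion P r S V₀ α m t / S t

/-- The number of bonds `η_t = (V_t - m C_t) / B_t`. -/
def cppiBond (P : RefiningGrids) (r S : ℝ → ℝ) (V₀ α m : ℝ) (t : ℝ) : ℝ :=
  (cppiValue P r S V₀ α m t - m * cppiCushion P r S V₀ α m t) / bond r t

end PathwiseCPPI

end

/-!
Call an array of reals indexed by grid and grid interval null on `[0, t]` if its sums up to time `s`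
tend to zero for every `s ∈ [0, t]`, and identify arrays that differ by a null array. For a path `X`
with continuous quadratic variation `(ΔX)² ≡ Δ[X]`. By summation over a fixed coarse grid, this
relation, and every other one between arrays with bounded absolute sums, may be multiplied by the
values of a continuous function at the left endpoints; Taylor's formula then becomes Itô's formula.
An Itô integral exists with value `Z` when `ξ ΔX ≡ ΔZ`, and for admissible `ξ` conversely.

In this calculus a self-financing strategy obeys the CPPI rules exactly when its cushion `C` solves
`ΔC ≡ C Δ(ℓ + ½[ℓ])`, where `exp ℓ` is the explicit cushion with initial value `1`. The function
`exp ℓ` is a solution by Itô's formula, and for any solution `C` the array `Δ(C exp(-ℓ))` is null,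
so that `C` is a multiple of `exp ℓ`.
-/

noncomputable section

namespace PathwiseCPPI

namespace TimeGrid

variable {G : TimeGrid} {t : ℝ} {i : ℕ}

theorem pt_nonneg (G : TimeGrid) (i : ℕ) : 0 ≤ G.pt i :=
  G.pt_zero ▸ G.strictMono.monotone i.zero_le

theorem pt_le_pt_succ (G : TimeGrid) (i : ℕ) : G.pt i ≤ G.pt (i + 1) :=
  G.strictMono.monotone i.le_succ

theorem pt_succ_mem_Icc (hi : i ∈ G.indices t) : G.pt (i + 1) ∈ Icc 0 t :=
  ⟨G.pt_nonneg _, mem_indices.1 hi⟩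

theorem pt_mem_Icc (hi : i ∈ G.indices t) : G.pt i ∈ Icc 0 t :=
  ⟨G.pt_nonneg i, (G.pt_le_pt_succ i).trans (mem_indices.1 hi)⟩

theorem indices_mono (G : TimeGrid) : Monotone G.indices :=
  fun _ _ h _ hi => mem_indices.2 ((mem_indices.1 hi).trans h)

theorem indices_zero (G : TimeGrid) : G.indices 0 = ∅ := by
  refine Finset.eq_empty_of_forall_notMem fun i hi => ?_
  exact ((G.strictMono i.succ_pos).trans_le (mem_indices.1 hi)).ne G.pt_zero

/-- The index of the last grid point not exceeding `t`. -/
def lastIndex (G : TimeGrid) (t : ℝ) : ℕ := (G.indices t).card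

theorem indices_eq_range (G : TimeGrid) (t : ℝ) : G.indices t = Finset.range (G.lastIndex t) := by
  have hlower : IsLowerSet (G.indices t : Set ℕ) := fun i j hji hi =>
    mem_indices.2 ((G.strictMono.monotone (by omega)).trans (mem_indices.1 hi))
  refine Finset.eq_of_subset_of_card_le (fun i hi => ?_) (by simp [lastIndex])
  have hsub : Finset.range (i + 1) ⊆ G.indices t := fun j hj =>
    hlower (Nat.lt_succ_iff.1 (Finset.mem_range.1 hj)) hi
  simpa [lastIndex, Nat.succ_le_iff] using Finset.card_le_card hsub

theorem lt_pt_lastIndex_succ (G : TimeGrid) (t : ℝ) : t < G.pt (G.lastIndex t + 1) := by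
  by_contra! h
  have hmem := mem_indices.2 h
  rw [indices_eq_range] at hmem
  exact Finset.notMem_range_self hmem

theorem pt_lastIndex_mem_Icc (G : TimeGrid) (ht : 0 ≤ t) : G.pt (G.lastIndex t) ∈ Icc 0 t := by
  rcases h : G.lastIndex t with _ | k
  · exact ⟨G.pt_nonneg 0, G.pt_zero.trans_le ht⟩
  · refine pt_succ_mem_Icc ?_
    rw [indices_eq_range, h]
    exact Finset.self_mem_range_succ k

end TimeGrid

namespace RefiningGrids

variable {t : ℝ}

theorem exists_pt_eq (P : RefiningGrids) {M N : ℕ} (h : M ≤ N) (i : ℕ) :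
    ∃ k, (P.grid N).pt k = (P.grid M).pt i :=
  monotone_nat_of_le_succ (f := fun N => (P.grid N).points) P.nested h ⟨i, rfl⟩

theorem eventually_step_lt (P : RefiningGrids) {δ : ℝ} (hδ : 0 < δ) :
    ∀ᶠ N in atTop, ∀ i, (P.grid N).pt (i + 1) - (P.grid N).pt i < δ := by
  filter_upwards [P.mesh_tendsto.eventually_lt_const (ENNReal.ofReal_pos.2 hδ)] with N hN i
  refine (le_abs_self _).trans_lt ((ENNReal.ofReal_lt_ofReal_iff hδ).1 (lt_of_le_of_lt ?_ hN))
  exact le_iSup (fun i => ENNReal.ofReal |(P.grid N).pt (i + 1) - (P.grid N).pt i|) i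

theorem eventually_sub_lastPt_lt (P : RefiningGrids) {δ : ℝ} (hδ : 0 < δ) :
    ∀ᶠ N in atTop, ∀ s, s - (P.grid N).pt ((P.grid N).lastIndex s) < δ := by
  filter_upwards [P.eventually_step_lt hδ] with N hN s
  linarith [hN ((P.grid N).lastIndex s), (P.grid N).lt_pt_lastIndex_succ s]

theorem tendsto_lastPt (P : RefiningGrids) (ht : 0 ≤ t) :
    Tendsto (fun N => (P.grid N).pt ((P.grid N).lastIndex t)) atTop (𝓝[Icc 0 t] t) := by
  have hmem : ∀ N, (P.grid N).pt ((P.grid N).lastIndex t) ∈ Icc 0 t := fun N =>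
    (P.grid N).pt_lastIndex_mem_Icc ht
  refine tendsto_nhdsWithin_iff.2 ⟨Metric.tendsto_nhds.2 fun ε hε => ?_, .of_forall hmem⟩
  filter_upwards [P.eventually_sub_lastPt_lt hε] with N hN
  rw [dist_comm, Real.dist_eq, abs_of_nonneg (sub_nonneg.2 (hmem N).2)]
  exact hN t

theorem monotone_lastPt (P : RefiningGrids) (ht : 0 ≤ t) :
    Monotone fun N => (P.grid N).pt ((P.grid N).lastIndex t) := by
  intro M N hMN
  obtain ⟨k, hk⟩ := P.exists_pt_eq hMN ((P.grid M).lastIndex t)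
  change (P.grid M).pt _ ≤ (P.grid N).pt _
  rw [← hk]
  refine (P.grid N).strictMono.monotone (Nat.lt_succ_iff.1 ((P.grid N).strictMono.lt_iff_lt.1 ?_))
  rw [hk]
  exact ((P.grid M).pt_lastIndex_mem_Icc ht).2.trans_lt ((P.grid N).lt_pt_lastIndex_succ t)

end RefiningGrids

theorem continuousOn_Ici_of_Icc {E : Type*} [TopologicalSpace E] {f : ℝ → E}
    (h : ∀ t > 0, ContinuousOn f (Icc 0 t)) : ContinuousOn f (Ici 0) := fun s (hs : 0 ≤ s) => by
  have hlt : s < s + 1 := lt_add_one s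
  exact (h (s + 1) (hs.trans_lt hlt) s ⟨hs, hlt.le⟩).mono_of_mem_nhdsWithin
    (inter_mem_nhdsWithin _ (Iic_mem_nhds hlt))

theorem exists_forall_abs_sub_le {f : ℝ → ℝ} {s : Set ℝ} (hs : IsCompact s)
    (hf : ContinuousOn f s) {ε : ℝ} (hε : 0 < ε) :
    ∃ δ > 0, ∀ x ∈ s, ∀ y ∈ s, |x - y| < δ → |f x - f y| ≤ ε := by
  obtain ⟨δ, hδ, h⟩ := Metric.uniformContinuousOn_iff.1 (hs.uniformContinuousOn_of_continuous hf)
    ε hε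
  exact ⟨δ, hδ, fun x hx y hy hxy => (h x hx y hy hxy).le⟩

theorem continuousOn_of_forall_le_abs_sub_le {f : ℝ → ℝ} {s : Set ℝ}
    (h : ∀ ε > 0, ∃ δ > 0, ∀ u ∈ s, ∀ v ∈ s, u ≤ v → v - u < δ → |f v - f u| ≤ ε) :
    ContinuousOn f s := by
  refine UniformContinuousOn.continuousOn (Metric.uniformContinuousOn_iff.2 fun ε hε => ?_)
  obtain ⟨δ, hδ, hf⟩ := h (ε / 2) (half_pos hε)
  refine ⟨δ, hδ, fun u hu v hv huv => lt_of_le_of_lt ?_ (half_lt_self hε)⟩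
  rw [Real.dist_eq, abs_lt] at huv
  rw [Real.dist_eq]
  rcases le_total u v with hle | hle
  · rw [abs_sub_comm]
    exact hf u hu v hv hle (by linarith)
  · exact hf v hv u hu hle huv.2

/-- A doubly indexed family of reals; the entry `(N, i)` is attached to the `i`-th interval of the
`N`-th grid. -/
abbrev GridArray := ℕ → ℕ → ℝ

/-- The array of increments `X(t_{i+1}) - X(t_i)`. -/
def inc (P : RefiningGrids) (X : ℝ → ℝ) : GridArray :=
  fun N i => X ((P.grid N).pt (i + 1)) - X ((P.grid N).pt i)

/-- The array of values `f(t_i)` at the left end points of the grid intervals. -/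
def val (P : RefiningGrids) (f : ℝ → ℝ) : GridArray := fun N i => f ((P.grid N).pt i)

/-- The sum of the `N`-th row of an array over the grid intervals contained in `[0, t]`. -/
def gridSum (P : RefiningGrids) (t : ℝ) (N : ℕ) : GridArray →ₗ[ℝ] ℝ where
  toFun e := ∑ i ∈ (P.grid N).indices t, e N i
  map_add' _ _ := Finset.sum_add_distrib
  map_smul' _ _ := (Finset.mul_sum _ _ _).symm

/-- The arrays whose entries on `[0, t]` tend to zero uniformly. -/
def unifSmall (P : RefiningGrids) (t : ℝ) : Submodule ℝ GridArray where
  carrier := {e | ∀ ε > 0, ∀ᶠ N in atTop, ∀ i ∈ (P.grid N).indices t, |e N i| ≤ ε}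
  zero_mem' _ hε := .of_forall fun _ _ _ => abs_zero.trans_le hε.le
  add_mem' {e f} he hf ε hε := by
    filter_upwards [he (ε / 2) (half_pos hε), hf (ε / 2) (half_pos hε)] with N heN hfN i hi
    exact (abs_add_le _ _).trans ((add_le_add (heN i hi) (hfN i hi)).trans_eq (add_halves ε))
  smul_mem' c e he ε hε := by
    filter_upwards [he (ε / (|c| + 1)) (by positivity)] with N heN i hi
    calc |c * e N i| ≤ (|c| + 1) * (ε / (|c| + 1)) := by
          rw [abs_mul]
          exact mul_le_mul (by simp) (heN i hi) (abs_nonneg _) (by positivity)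
      _ = ε := mul_div_cancel₀ ε (by positivity)

/-- The arrays whose absolute row sums over `[0, t]` are eventually bounded. -/
def sumBounded (P : RefiningGrids) (t : ℝ) : Submodule ℝ GridArray where
  carrier := {e | ∃ K, ∀ᶠ N in atTop, ∑ i ∈ (P.grid N).indices t, |e N i| ≤ K}
  zero_mem' := ⟨0, by simp⟩
  add_mem' := by
    rintro e f ⟨K, hK⟩ ⟨L, hL⟩
    refine ⟨K + L, ?_⟩
    filter_upwards [hK, hL] with N hKN hLN
    calc ∑ i ∈ (P.grid N).indices t, |e N i + f N i|
        ≤ ∑ i ∈ (P.grid N).indices t, (|e N i| + |f N i|) :=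
          Finset.sum_le_sum fun i _ => abs_add_le _ _
      _ ≤ K + L := Finset.sum_add_distrib.trans_le (add_le_add hKN hLN)
  smul_mem' := by
    rintro c e ⟨K, hK⟩
    refine ⟨|c| * K, ?_⟩
    filter_upwards [hK] with N hKN
    simpa only [Pi.smul_apply, smul_eq_mul, abs_mul, ← Finset.mul_sum]
      using mul_le_mul_of_nonneg_left hKN (abs_nonneg c)

/-- The arrays with bounded absolute row sums whose (signed) row sums over `[0, s]` tend to zero for
every `s ≤ t`. Two arrays that agree modulo this submodule have the same limiting sums. -/
def nullArrays (P : RefiningGrids) (t : ℝ) : Submodule ℝ GridArray where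
  carrier := {e | e ∈ sumBounded P t ∧
    ∀ s ∈ Icc 0 t, Tendsto (fun N => gridSum P s N e) atTop (𝓝 0)}
  zero_mem' := ⟨zero_mem _, fun s _ => by simp⟩
  add_mem' he hf := ⟨add_mem he.1 hf.1, fun s hs => by
    simpa using (he.2 s hs).add (hf.2 s hs)⟩
  smul_mem' c _ he := ⟨Submodule.smul_mem _ c he.1, fun s hs => by
    simpa using (he.2 s hs).const_mul c⟩

section Arrays

variable {P : RefiningGrids} {t : ℝ} {e f : GridArray} {X : ℝ → ℝ}

theorem gridSum_inc (P : RefiningGrids) (X : ℝ → ℝ) (t : ℝ) (N : ℕ) :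
    gridSum P t N (inc P X) = X ((P.grid N).pt ((P.grid N).lastIndex t)) - X 0 := by
  simp only [gridSum, inc, LinearMap.coe_mk, AddHom.coe_mk, TimeGrid.indices_eq_range,
    Finset.sum_range_sub fun i => X ((P.grid N).pt i), (P.grid N).pt_zero]

theorem tendsto_gridSum_inc (ht : 0 ≤ t) (hX : ContinuousOn X (Icc 0 t)) :
    Tendsto (fun N => gridSum P t N (inc P X)) atTop (𝓝 (X t - X 0)) := by
  simp only [gridSum_inc]
  exact ((hX t (right_mem_Icc.2 ht)).tendsto.comp (P.tendsto_lastPt ht)).sub_const _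

theorem abs_gridSum_le (P : RefiningGrids) {s : ℝ} (hs : s ≤ t) (N : ℕ) (e : GridArray) :
    |gridSum P s N e| ≤ ∑ i ∈ (P.grid N).indices t, |e N i| :=
  (Finset.abs_sum_le_sum_abs _ _).trans <| Finset.sum_le_sum_of_subset_of_nonneg
    ((P.grid N).indices_mono hs) fun _ _ _ => abs_nonneg _

theorem mem_sumBounded_of_le {C : ℝ} (hf : f ∈ sumBounded P t)
    (h : ∀ᶠ N in atTop, ∀ i ∈ (P.grid N).indices t, |e N i| ≤ C * |f N i|) :
    e ∈ sumBounded P t := by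
  obtain ⟨K, hK⟩ := hf
  refine ⟨|C| * K, ?_⟩
  filter_upwards [hK, h] with N hKN hN
  refine le_trans ?_ (mul_le_mul_of_nonneg_left hKN (abs_nonneg C))
  rw [Finset.mul_sum]
  exact Finset.sum_le_sum fun i hi => (hN i hi).trans
    (mul_le_mul_of_nonneg_right (le_abs_self C) (abs_nonneg _))

theorem mem_nullArrays_of_le (hf : f ∈ sumBounded P t)
    (h : ∀ ε > 0, ∀ᶠ N in atTop, ∀ i ∈ (P.grid N).indices t, |e N i| ≤ ε * |f N i|) :
    e ∈ nullArrays P t := by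
  refine ⟨mem_sumBounded_of_le hf (h 1 one_pos), fun s hs => Metric.tendsto_nhds.2 fun ε hε => ?_⟩
  obtain ⟨K, hK⟩ := hf
  filter_upwards [hK, h (ε / (|K| + 1)) (by positivity)] with N hKN hN
  rw [dist_zero_right]
  calc |gridSum P s N e| ≤ ∑ i ∈ (P.grid N).indices t, |e N i| := abs_gridSum_le P hs.2 N e
    _ ≤ ε / (|K| + 1) * ∑ i ∈ (P.grid N).indices t, |f N i| := by
        rw [Finset.mul_sum]
        exact Finset.sum_le_sum hN
    _ < ε / (|K| + 1) * (|K| + 1) :=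
        mul_lt_mul_of_pos_left (by linarith [le_abs_self K]) (by positivity)
    _ = ε := div_mul_cancel₀ ε (by positivity)

theorem mul_mem_nullArrays (he : e ∈ unifSmall P t) (hf : f ∈ sumBounded P t) :
    e * f ∈ nullArrays P t :=
  mem_nullArrays_of_le hf fun ε hε => (he ε hε).mono fun _ hN i hi =>
    (abs_mul _ _).trans_le (mul_le_mul_of_nonneg_right (hN i hi) (abs_nonneg _))

theorem exists_abs_val_le (hX : ContinuousOn X (Icc 0 t)) :
    ∃ K > 0, ∀ N, ∀ i ∈ (P.grid N).indices t, |val P X N i| ≤ K := by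
  obtain ⟨K, hK⟩ := isCompact_Icc.exists_bound_of_continuousOn hX
  exact ⟨max K 1, by positivity, fun N i hi =>
    (hK _ (TimeGrid.pt_mem_Icc hi)).trans (le_max_left _ _)⟩

theorem val_mul_mem_sumBounded (hX : ContinuousOn X (Icc 0 t)) (he : e ∈ sumBounded P t) :
    val P X * e ∈ sumBounded P t := by
  obtain ⟨K, _, hK⟩ := exists_abs_val_le (P := P) hX
  exact mem_sumBounded_of_le he (.of_forall fun N i hi =>
    (abs_mul _ _).trans_le (mul_le_mul_of_nonneg_right (hK N i hi) (abs_nonneg _)))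

theorem val_mul_mem_unifSmall (hX : ContinuousOn X (Icc 0 t)) (he : e ∈ unifSmall P t) :
    val P X * e ∈ unifSmall P t := by
  obtain ⟨K, hK₀, hK⟩ := exists_abs_val_le (P := P) hX
  intro ε hε
  filter_upwards [he (ε / K) (by positivity)] with N hN i hi
  calc |val P X N i * e N i| ≤ K * (ε / K) := by
        rw [abs_mul]
        exact mul_le_mul (hK N i hi) (hN i hi) (abs_nonneg _) hK₀.le
    _ = ε := mul_div_cancel₀ ε hK₀.ne'

theorem inc_mem_unifSmall (hX : ContinuousOn X (Icc 0 t)) : inc P X ∈ unifSmall P t := by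
  intro ε hε
  obtain ⟨δ, hδ, h⟩ := exists_forall_abs_sub_le isCompact_Icc hX hε
  filter_upwards [P.eventually_step_lt hδ] with N hN i hi
  refine h _ (TimeGrid.pt_succ_mem_Icc hi) _ (TimeGrid.pt_mem_Icc hi) ?_
  rw [abs_of_nonneg (sub_nonneg.2 ((P.grid N).pt_le_pt_succ i))]
  exact hN i

theorem inc_mem_sumBounded (ht : 0 ≤ t) (hX : BoundedVariationOn X (Icc 0 t)) :
    inc P X ∈ sumBounded P t := by
  refine ⟨(eVariationOn X (Icc 0 t)).toReal, .of_forall fun N => ?_⟩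
  have hmono := (P.grid N).strictMono.monotone
  have hsum : ∑ i ∈ (P.grid N).indices t, edist (X ((P.grid N).pt (i + 1))) (X ((P.grid N).pt i)) ≤
      eVariationOn X (Icc 0 t) := by
    rw [TimeGrid.indices_eq_range]
    exact eVariationOn.sum_le_of_monotoneOn_Iic (hmono.monotoneOn _) fun i hi =>
      ⟨(P.grid N).pt_nonneg i, (hmono hi).trans ((P.grid N).pt_lastIndex_mem_Icc ht).2⟩
  have hreal := ENNReal.toReal_mono hX hsum
  rwa [ENNReal.toReal_sum fun _ _ => edist_ne_top _ _] at hreal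

/-! ### Multiplication of null arrays by continuous functions -/

theorem eventually_abs_sub_lastPt_le (P : RefiningGrids) (hX : ContinuousOn X (Icc 0 t)) {ε : ℝ}
    (hε : 0 < ε) : ∀ᶠ M in atTop, ∀ s ∈ Icc 0 t,
      |X s - X ((P.grid M).pt ((P.grid M).lastIndex s))| ≤ ε := by
  obtain ⟨δ, hδ, h⟩ := exists_forall_abs_sub_le isCompact_Icc hX hε
  filter_upwards [P.eventually_sub_lastPt_lt hδ] with M hM s hs
  have hlast := (P.grid M).pt_lastIndex_mem_Icc hs.1
  refine h s hs _ ⟨hlast.1, hlast.2.trans hs.2⟩ ?_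
  rw [abs_of_nonneg (sub_nonneg.2 hlast.2)]
  exact hM s

theorem sum_ite_pt_le (P : RefiningGrids) {M N k : ℕ} (h : M ≤ N) (hk : (P.grid M).pt k ≤ t)
    (e : GridArray) :
    (∑ i ∈ (P.grid N).indices t, if (P.grid M).pt k ≤ (P.grid N).pt i then e N i else 0) =
      gridSum P t N e - gridSum P ((P.grid M).pt k) N e := by
  obtain ⟨j, hj⟩ := P.exists_pt_eq h k
  have hfilter : {i ∈ (P.grid N).indices t | ¬ (P.grid M).pt k ≤ (P.grid N).pt i} =
      (P.grid N).indices ((P.grid M).pt k) := by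
    ext i
    simp only [Finset.mem_filter, TimeGrid.mem_indices, ← hj, (P.grid N).strictMono.le_iff_le,
      not_le, Nat.lt_iff_add_one_le, and_iff_right_iff_imp]
    exact fun hi => ((P.grid N).strictMono.monotone hi).trans (hj.trans_le hk)
  rw [eq_sub_iff_add_eq, ← Finset.sum_filter, gridSum, gridSum, LinearMap.coe_mk, LinearMap.coe_mk,
    AddHom.coe_mk, AddHom.coe_mk, ← hfilter, Finset.sum_filter_add_sum_filter_not]

theorem gridSum_val_lastPt_mul (P : RefiningGrids) (X : ℝ → ℝ) (t : ℝ) (e : GridArray) {M N : ℕ}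
    (h : M ≤ N) :
    gridSum P t N (val P (fun s => X ((P.grid M).pt ((P.grid M).lastIndex s))) * e) =
      X 0 * gridSum P t N e + ∑ k ∈ (P.grid M).indices t, inc P X M k *
        (gridSum P t N e - gridSum P ((P.grid M).pt (k + 1)) N e) := by
  have hval : ∀ i ∈ (P.grid N).indices t,
      X ((P.grid M).pt ((P.grid M).lastIndex ((P.grid N).pt i))) = X 0 +
        ∑ k ∈ (P.grid M).indices t,
          if (P.grid M).pt (k + 1) ≤ (P.grid N).pt i then inc P X M k else 0 := by
    intro i hi
    rw [← sub_eq_iff_eq_add', ← gridSum_inc, ← Finset.sum_filter]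
    refine Finset.sum_congr (Finset.ext fun k => ?_) fun _ _ => rfl
    simp only [Finset.mem_filter, TimeGrid.mem_indices, iff_and_self]
    exact fun hk => hk.trans (TimeGrid.pt_mem_Icc hi).2
  have hswap : ∀ k ∈ (P.grid M).indices t,
      inc P X M k * (gridSum P t N e - gridSum P ((P.grid M).pt (k + 1)) N e) =
        ∑ i ∈ (P.grid N).indices t,
          (if (P.grid M).pt (k + 1) ≤ (P.grid N).pt i then inc P X M k else 0) * e N i := by
    intro k hk
    rw [← sum_ite_pt_le P h (TimeGrid.mem_indices.1 hk), Finset.mul_sum]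
    exact Finset.sum_congr rfl fun i _ => by split_ifs <;> simp
  rw [Finset.sum_congr rfl hswap, Finset.sum_comm]
  simp only [gridSum, LinearMap.coe_mk, AddHom.coe_mk, Finset.mul_sum, ← Finset.sum_add_distrib]
  refine Finset.sum_congr rfl fun i hi => ?_
  rw [Pi.mul_apply, Pi.mul_apply, val, hval i hi, add_mul, Finset.sum_mul]

theorem tendsto_gridSum_val_lastPt_mul (P : RefiningGrids) (X : ℝ → ℝ) (ht : 0 ≤ t)
    (he : e ∈ nullArrays P t) (M : ℕ) :
    Tendsto (fun N => gridSum P t N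
      (val P (fun s => X ((P.grid M).pt ((P.grid M).lastIndex s))) * e)) atTop (𝓝 0) := by
  have hsum : Tendsto (fun N => X 0 * gridSum P t N e + ∑ k ∈ (P.grid M).indices t,
      inc P X M k * (gridSum P t N e - gridSum P ((P.grid M).pt (k + 1)) N e)) atTop
      (𝓝 (X 0 * 0 + ∑ k ∈ (P.grid M).indices t, inc P X M k * (0 - 0))) :=
    ((he.2 t (right_mem_Icc.2 ht)).const_mul _).add (tendsto_finsetSum _ fun k hk =>
      ((he.2 t (right_mem_Icc.2 ht)).sub (he.2 _ (TimeGrid.pt_succ_mem_Icc hk))).const_mul _)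
  simp only [mul_zero, sub_zero, Finset.sum_const_zero, add_zero] at hsum
  exact hsum.congr' ((eventually_ge_atTop M).mono fun N hN =>
    (gridSum_val_lastPt_mul P X t e hN).symm)

theorem nullArrays_mono {s : ℝ} (h : s ≤ t) : nullArrays P t ≤ nullArrays P s := by
  rintro e ⟨⟨K, hK⟩, he⟩
  refine ⟨⟨K, hK.mono fun N hN => le_trans ?_ hN⟩, fun u hu => he u ⟨hu.1, hu.2.trans h⟩⟩
  exact Finset.sum_le_sum_of_subset_of_nonneg ((P.grid N).indices_mono h) fun _ _ _ => abs_nonneg _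

theorem tendsto_gridSum_val_mul (ht : 0 ≤ t) (hX : ContinuousOn X (Icc 0 t))
    (he : e ∈ nullArrays P t) : Tendsto (fun N => gridSum P t N (val P X * e)) atTop (𝓝 0) := by
  obtain ⟨K, hK⟩ := he.1
  refine Metric.tendsto_nhds.2 fun ε hε => ?_
  set δ := ε / (2 * (|K| + 1)) with hδ_def
  obtain ⟨M, hM⟩ := (eventually_abs_sub_lastPt_le P hX (ε := δ) (by positivity)).exists
  have hstep := tendsto_gridSum_val_lastPt_mul P X ht he M
  filter_upwards [hK, Metric.tendsto_nhds.1 hstep (ε / 2) (half_pos hε)] with N hKN hN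
  set g : ℝ → ℝ := fun s => X ((P.grid M).pt ((P.grid M).lastIndex s))
  have hdiff : |gridSum P t N (val P X * e) - gridSum P t N (val P g * e)| ≤ ε / 2 := by
    rw [← map_sub, ← sub_mul]
    calc |gridSum P t N ((val P X - val P g) * e)|
        ≤ ∑ i ∈ (P.grid N).indices t, |(val P X N i - val P g N i) * e N i| :=
          abs_gridSum_le P le_rfl N _
      _ ≤ ∑ i ∈ (P.grid N).indices t, δ * |e N i| := Finset.sum_le_sum fun i hi =>
          (abs_mul _ _).trans_le (mul_le_mul_of_nonneg_right
            (hM _ (TimeGrid.pt_mem_Icc hi)) (abs_nonneg _))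
      _ ≤ δ * (|K| + 1) := by
          rw [← Finset.mul_sum]
          exact mul_le_mul_of_nonneg_left (by linarith [le_abs_self K]) (by positivity)
      _ = ε / 2 := by rw [hδ_def]; field_simp
  rw [dist_zero_right, Real.norm_eq_abs] at hN ⊢
  linarith [abs_sub_abs_le_abs_sub (gridSum P t N (val P X * e)) (gridSum P t N (val P g * e))]

theorem val_mul_mem_nullArrays (hX : ContinuousOn X (Icc 0 t)) (he : e ∈ nullArrays P t) :
    val P X * e ∈ nullArrays P t :=
  ⟨val_mul_mem_sumBounded hX he.1, fun _ hs => tendsto_gridSum_val_mul hs.1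
    (hX.mono (Icc_subset_Icc_right hs.2)) (nullArrays_mono hs.2 he)⟩

theorem val_mul_smodEq (hX : ContinuousOn X (Icc 0 t)) (h : e ≡ f [SMOD nullArrays P t]) :
    val P X * e ≡ val P X * f [SMOD nullArrays P t] := by
  rw [SModEq.sub_mem] at h ⊢
  rw [← mul_sub]
  exact val_mul_mem_nullArrays hX h

theorem tendsto_gridSum_of_smodEq (h : e ≡ f [SMOD nullArrays P t]) {s l : ℝ} (hs : s ∈ Icc 0 t)
    (hf : Tendsto (fun N => gridSum P s N f) atTop (𝓝 l)) :
    Tendsto (fun N => gridSum P s N e) atTop (𝓝 l) := by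
  simpa using ((SModEq.sub_mem.1 h).2 s hs).add hf

theorem mem_sumBounded_of_smodEq (h : e ≡ f [SMOD nullArrays P t]) (hf : f ∈ sumBounded P t) :
    e ∈ sumBounded P t := by
  simpa using add_mem (SModEq.sub_mem.1 h).1 hf

end Arrays

theorem boundedVariationOn_of_abs_sub_le {X R : ℝ → ℝ} {a b : ℝ}
    (h : ∀ u ∈ Icc a b, ∀ v ∈ Icc a b, u ≤ v → |X v - X u| ≤ R v - R u) :
    BoundedVariationOn X (Icc a b) := by
  have hmono : MonotoneOn R (Icc a b) := fun u hu v hv huv =>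
    sub_nonneg.1 ((abs_nonneg _).trans (h u hu v hv huv))
  have hR : BoundedVariationOn R (Icc a b) := by
    refine hmono.boundedVariationOn (C := max |R a| |R b|) fun x hx => ?_
    have hab := hx.1.trans hx.2
    exact abs_le_max_abs_abs (hmono (left_mem_Icc.2 hab) hx hx.1)
      (hmono hx (right_mem_Icc.2 hab) hx.2)
  refine ne_top_of_le_ne_top hR (iSup_mono fun p => Finset.sum_le_sum fun i _ => ?_)
  rw [edist_dist, edist_dist]
  refine ENNReal.ofReal_le_ofReal ((h _ (p.2.2.2 i) _ (p.2.2.2 (i + 1)) ?_).trans (le_abs_self _))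
  exact p.2.2.1 i.le_succ

/-! ### Quadratic variation and the Itô formula -/

section QuadraticVariation

variable {P : RefiningGrids} {t : ℝ} {e f : GridArray} {X Z : ℝ → ℝ}

theorem abs_sub_le_of_tendsto_gridSum {u v a b c d : ℝ} (huv : u ≤ v)
    (h : ∀ N, ∀ i ∈ (P.grid N).indices v, |e N i| ≤ f N i)
    (heu : Tendsto (fun N => gridSum P u N e) atTop (𝓝 a))
    (hev : Tendsto (fun N => gridSum P v N e) atTop (𝓝 b))
    (hfu : Tendsto (fun N => gridSum P u N f) atTop (𝓝 c))
    (hfv : Tendsto (fun N => gridSum P v N f) atTop (𝓝 d)) : |b - a| ≤ d - c := by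
  refine le_of_tendsto_of_tendsto' (hev.sub heu).abs (hfv.sub hfu) fun N => ?_
  have hsub := (P.grid N).indices_mono huv
  simp only [gridSum, LinearMap.coe_mk, AddHom.coe_mk, ← Finset.sum_sdiff_eq_sub hsub]
  exact (Finset.abs_sum_le_sum_abs _ _).trans
    (Finset.sum_le_sum fun i hi => h N i (Finset.mem_sdiff.1 hi).1)

theorem mem_sumBounded_of_tendsto_gridSum {l : ℝ}
    (h : ∀ N, ∀ i ∈ (P.grid N).indices t, 0 ≤ e N i)
    (he : Tendsto (fun N => gridSum P t N e) atTop (𝓝 l)) : e ∈ sumBounded P t := by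
  refine ⟨l + 1, (he.eventually_le_const (lt_add_one l)).mono fun N hN => ?_⟩
  rwa [Finset.sum_congr rfl fun i hi => abs_of_nonneg (h N i hi)]

theorem smodEq_inc_of_tendsto_gridSum (hZ : ContinuousOn Z (Icc 0 t))
    (hb : e - inc P Z ∈ sumBounded P t)
    (h : ∀ s ∈ Icc 0 t, Tendsto (fun N => gridSum P s N e) atTop (𝓝 (Z s - Z 0))) :
    e ≡ inc P Z [SMOD nullArrays P t] := by
  refine SModEq.sub_mem.2 ⟨hb, fun s hs => ?_⟩
  have hinc := tendsto_gridSum_inc (P := P) hs.1 (hZ.mono (Icc_subset_Icc_right hs.2))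
  simpa using (h s hs).sub hinc

theorem quadVar_zero (P : RefiningGrids) (X : ℝ → ℝ) : quadVar P X 0 = 0 := by
  have h : quadVarSum P X 0 = fun _ => 0 :=
    funext fun N => by simp [quadVarSum, TimeGrid.indices_zero]
  rw [quadVar, h]
  exact tendsto_const_nhds.limUnder_eq

namespace HasContinuousQuadVar

theorem tendsto_gridSum (h : HasContinuousQuadVar P X) (ht : 0 ≤ t) :
    Tendsto (fun N => gridSum P t N (inc P X ^ 2)) atTop (𝓝 (quadVar P X t)) := by
  rcases ht.eq_or_lt with rfl | ht
  · simp [quadVar_zero, gridSum, TimeGrid.indices_zero]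
  · exact tendsto_nhds_limUnder (h.1 t ht)

theorem abs_quadVar_sub_le (h : HasContinuousQuadVar P X) {u v : ℝ} (hu : 0 ≤ u) (huv : u ≤ v) :
    |quadVar P X v - quadVar P X u| ≤ quadVar P X v - quadVar P X u :=
  have hlim_u := h.tendsto_gridSum hu
  have hlim_v := h.tendsto_gridSum (hu.trans huv)
  abs_sub_le_of_tendsto_gridSum huv (fun _ _ _ => (abs_of_nonneg (sq_nonneg _)).le) hlim_u hlim_v
    hlim_u hlim_v

theorem boundedVariationOn (h : HasContinuousQuadVar P X) :
    BoundedVariationOn (quadVar P X) (Icc 0 t) :=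
  boundedVariationOn_of_abs_sub_le fun _ hu _ _ huv => h.abs_quadVar_sub_le hu.1 huv

theorem continuousOn (h : HasContinuousQuadVar P X) : ContinuousOn (quadVar P X) (Icc 0 t) :=
  h.2.mono Icc_subset_Ici_self

theorem sq_inc_smodEq (h : HasContinuousQuadVar P X) (ht : 0 ≤ t) :
    inc P X ^ 2 ≡ inc P (quadVar P X) [SMOD nullArrays P t] := by
  refine smodEq_inc_of_tendsto_gridSum h.continuousOn (sub_mem ?_ ?_) fun s hs => ?_
  · exact mem_sumBounded_of_tendsto_gridSum (fun _ _ _ => sq_nonneg _) (h.tendsto_gridSum ht)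
  · exact inc_mem_sumBounded ht h.boundedVariationOn
  · simpa [quadVar_zero] using h.tendsto_gridSum hs.1

theorem inc_const_mul_mem_sumBounded (h : HasContinuousQuadVar P X) (ht : 0 ≤ t) (c : ℝ) :
    inc P (fun s => c * quadVar P X s) ∈ sumBounded P t := by
  convert Submodule.smul_mem _ c (inc_mem_sumBounded (P := P) ht h.boundedVariationOn) using 1
  ext N i
  exact (mul_sub _ _ _).symm

end HasContinuousQuadVar

theorem hasContinuousQuadVar_of_smodEq
    (h : ∀ T > 0, ∃ Q, ContinuousOn Q (Icc 0 T) ∧ inc P X ^ 2 ≡ inc P Q [SMOD nullArrays P T]) :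
    HasContinuousQuadVar P X := by
  have hlim : ∀ {T Q}, ContinuousOn Q (Icc 0 T) → inc P X ^ 2 ≡ inc P Q [SMOD nullArrays P T] →
      ∀ s ∈ Icc 0 T, Tendsto (quadVarSum P X s) atTop (𝓝 (Q s - Q 0)) :=
    fun hQ heq s hs => tendsto_gridSum_of_smodEq heq hs
      (tendsto_gridSum_inc hs.1 (hQ.mono (Icc_subset_Icc_right hs.2)))
  refine ⟨fun t ht => ?_, continuousOn_Ici_of_Icc fun t ht => ?_⟩ <;>
    obtain ⟨Q, hQ, heq⟩ := h t ht
  · exact ⟨_, hlim hQ heq t (right_mem_Icc.2 ht.le)⟩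
  · exact (hQ.sub continuousOn_const).congr fun s hs => (hlim hQ heq s hs).limUnder_eq

end QuadraticVariation

section Taylor

variable {F F' F'' : ℝ → ℝ} {x y c ε : ℝ}

theorem abs_sub_sub_mul_le_of_hasDerivAt (hF : ∀ z ∈ uIcc x y, HasDerivAt F (F' z) z)
    (h : ∀ z ∈ uIcc x y, |F' z - c| ≤ ε) : |F y - F x - c * (y - x)| ≤ ε * |y - x| := by
  have hderiv : ∀ z ∈ uIcc x y,
      HasDerivWithinAt (fun z => F z - c * z) (F' z - c) (uIcc x y) z := fun z hz =>
    (((hF z hz).sub ((hasDerivAt_id z).const_mul c)).congr_deriv (by rw [mul_one])).hasDerivWithinAt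
  refine le_of_eq_of_le (congrArg abs ?_)
    ((convex_uIcc x y).norm_image_sub_le_of_norm_hasDerivWithin_le hderiv h left_mem_uIcc
      right_mem_uIcc)
  ring

theorem abs_taylor_two_sub_le_of_hasDerivAt (hF : ∀ z ∈ uIcc x y, HasDerivAt F (F' z) z)
    (hF' : ∀ z ∈ uIcc x y, HasDerivAt F' (F'' z) z) (h : ∀ z ∈ uIcc x y, |F'' z - c| ≤ ε) :
    |F y - F x - F' x * (y - x) - c / 2 * (y - x) ^ 2| ≤ ε * (y - x) ^ 2 := by
  have hε : 0 ≤ ε := (abs_nonneg _).trans (h x left_mem_uIcc)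
  have hderiv : ∀ z ∈ uIcc x y, HasDerivAt (fun z => F z - F' x * z - c / 2 * (z - x) ^ 2)
      (F' z - F' x - c * (z - x)) z := fun z hz => by
    refine (((hF z hz).sub ((hasDerivAt_id z).const_mul (F' x))).sub
      ((((hasDerivAt_id z).sub_const x).pow 2).const_mul (c / 2))).congr_deriv ?_
    simp only [id]
    ring
  have hbound : ∀ z ∈ uIcc x y, |F' z - F' x - c * (z - x) - 0| ≤ ε * |y - x| := fun z hz => by
    have hsub := uIcc_subset_uIcc_left hz
    rw [sub_zero]
    exact (abs_sub_sub_mul_le_of_hasDerivAt (fun w hw => hF' w (hsub hw))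
      fun w hw => h w (hsub hw)).trans
      (mul_le_mul_of_nonneg_left (abs_sub_left_of_mem_uIcc hz) hε)
  have := abs_sub_sub_mul_le_of_hasDerivAt hderiv hbound
  rw [mul_assoc, ← sq, sq_abs] at this
  refine le_of_eq_of_le (congrArg abs ?_) this
  ring

end Taylor

section ItoFormula

variable {P : RefiningGrids} {t : ℝ} {X Q F F' F'' : ℝ → ℝ}

theorem uIcc_subset_image_Icc (hX : ContinuousOn X (Icc 0 t)) {N i : ℕ}
    (hi : i ∈ (P.grid N).indices t) :
    uIcc (X ((P.grid N).pt i)) (X ((P.grid N).pt (i + 1))) ⊆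
      X '' Icc ((P.grid N).pt i) ((P.grid N).pt (i + 1)) := by
  have hsub := ordConnected_Icc.out (TimeGrid.pt_mem_Icc hi) (TimeGrid.pt_succ_mem_Icc hi)
  rw [← uIcc_of_le ((P.grid N).pt_le_pt_succ i)] at hsub ⊢
  exact intermediate_value_uIcc (hX.mono hsub)

theorem eventually_forall_uIcc_abs_sub_le {f : ℝ → ℝ} {ε : ℝ} (hX : ContinuousOn X (Icc 0 t))
    (hf : ContinuousOn (fun s => f (X s)) (Icc 0 t)) (hε : 0 < ε) :
    ∀ᶠ N in atTop, ∀ i ∈ (P.grid N).indices t,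
      ∀ z ∈ uIcc (X ((P.grid N).pt i)) (X ((P.grid N).pt (i + 1))),
        |f z - f (X ((P.grid N).pt i))| ≤ ε := by
  obtain ⟨δ, hδ, h⟩ := exists_forall_abs_sub_le isCompact_Icc hf hε
  filter_upwards [P.eventually_step_lt hδ] with N hN i hi z hz
  obtain ⟨s, hs, rfl⟩ := uIcc_subset_image_Icc hX hi hz
  refine h s ⟨((P.grid N).pt_nonneg i).trans hs.1, hs.2.trans (TimeGrid.mem_indices.1 hi)⟩ _
    (TimeGrid.pt_mem_Icc hi) ?_
  rw [abs_of_nonneg (sub_nonneg.2 hs.1)]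
  linarith [hN i, hs.2]

theorem sq_inc_comp_smodEq (hX : ContinuousOn X (Icc 0 t)) (hb : inc P X ^ 2 ∈ sumBounded P t)
    (hF : ∀ s ∈ Icc 0 t, HasDerivAt F (F' (X s)) (X s))
    (hF' : ContinuousOn (fun s => F' (X s)) (Icc 0 t)) :
    inc P (fun s => F (X s)) ^ 2 ≡ val P (fun s => F' (X s) ^ 2) * inc P X ^ 2
      [SMOD nullArrays P t] := by
  obtain ⟨K, hK₀, hK⟩ := exists_abs_val_le (P := P) hF'
  refine SModEq.sub_mem.2 (mem_nullArrays_of_le hb fun ε hε => ?_)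
  set δ := min 1 (ε / (2 * K + 1))
  have hδ : 0 < δ := by positivity
  filter_upwards [eventually_forall_uIcc_abs_sub_le hX hF' hδ] with N hN i hi
  set x := X ((P.grid N).pt i)
  set y := X ((P.grid N).pt (i + 1))
  have hsub := (uIcc_subset_image_Icc hX hi).trans
    (image_mono (ordConnected_Icc.out (TimeGrid.pt_mem_Icc hi) (TimeGrid.pt_succ_mem_Icc hi)))
  have hlin : |F y - F x - F' x * (y - x)| ≤ δ * |y - x| :=
    abs_sub_sub_mul_le_of_hasDerivAt
      (fun z hz => by obtain ⟨s, hs, rfl⟩ := hsub hz; exact hF s hs) (hN i hi)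
  have hsum : |F y - F x + F' x * (y - x)| ≤ (2 * K + 1) * |y - x| :=
    calc |F y - F x + F' x * (y - x)|
        = |F y - F x - F' x * (y - x) + 2 * (F' x * (y - x))| := by ring_nf
      _ ≤ 1 * |y - x| + 2 * (K * |y - x|) := by
          refine (abs_add_le _ _).trans (add_le_add (hlin.trans ?_) ?_)
          · exact mul_le_mul_of_nonneg_right (min_le_left _ _) (abs_nonneg _)
          · rw [abs_mul, abs_two, abs_mul]
            exact mul_le_mul_of_nonneg_left
              (mul_le_mul_of_nonneg_right (hK N i hi) (abs_nonneg _)) zero_le_two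
      _ = (2 * K + 1) * |y - x| := by ring
  calc |(F y - F x) ^ 2 - F' x ^ 2 * (y - x) ^ 2|
      = |F y - F x - F' x * (y - x)| * |F y - F x + F' x * (y - x)| := by
        rw [← abs_mul]
        ring_nf
    _ ≤ (ε / (2 * K + 1) * |y - x|) * ((2 * K + 1) * |y - x|) :=
        mul_le_mul (hlin.trans (mul_le_mul_of_nonneg_right (min_le_right _ _) (abs_nonneg _))) hsum
          (abs_nonneg _) (by positivity)
    _ = ε * |(y - x) ^ 2| := by
        rw [abs_pow]
        field_simp

theorem inc_comp_smodEq_sq (hX : ContinuousOn X (Icc 0 t)) (hb : inc P X ^ 2 ∈ sumBounded P t)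
    (hF : ∀ s ∈ Icc 0 t, HasDerivAt F (F' (X s)) (X s))
    (hF' : ∀ s ∈ Icc 0 t, HasDerivAt F' (F'' (X s)) (X s))
    (hF'' : ContinuousOn (fun s => F'' (X s)) (Icc 0 t)) :
    inc P (fun s => F (X s)) ≡ val P (fun s => F' (X s)) * inc P X +
      val P (fun s => F'' (X s) / 2) * inc P X ^ 2 [SMOD nullArrays P t] := by
  refine SModEq.sub_mem.2 (mem_nullArrays_of_le hb fun ε hε => ?_)
  filter_upwards [eventually_forall_uIcc_abs_sub_le hX hF'' hε] with N hN i hi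
  have hsub := (uIcc_subset_image_Icc hX hi).trans
    (image_mono (ordConnected_Icc.out (TimeGrid.pt_mem_Icc hi) (TimeGrid.pt_succ_mem_Icc hi)))
  have htaylor := abs_taylor_two_sub_le_of_hasDerivAt (F := F) (F' := F')
    (fun z hz => by obtain ⟨s, hs, rfl⟩ := hsub hz; exact hF s hs)
    (fun z hz => by obtain ⟨s, hs, rfl⟩ := hsub hz; exact hF' s hs) (hN i hi)
  rw [sub_sub] at htaylor
  exact htaylor.trans_eq (congrArg (ε * ·) (abs_sq _).symm)

theorem inc_comp_smodEq (hX : ContinuousOn X (Icc 0 t)) (hQ : inc P Q ∈ sumBounded P t)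
    (hXQ : inc P X ^ 2 ≡ inc P Q [SMOD nullArrays P t])
    (hF : ∀ s ∈ Icc 0 t, HasDerivAt F (F' (X s)) (X s))
    (hF' : ∀ s ∈ Icc 0 t, HasDerivAt F' (F'' (X s)) (X s))
    (hF'' : ContinuousOn (fun s => F'' (X s)) (Icc 0 t)) :
    inc P (fun s => F (X s)) ≡ val P (fun s => F' (X s)) * inc P X +
      val P (fun s => F'' (X s) / 2) * inc P Q [SMOD nullArrays P t] :=
  (inc_comp_smodEq_sq hX (mem_sumBounded_of_smodEq hXQ hQ) hF hF' hF'').trans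
    (SModEq.rfl.add (val_mul_smodEq (hF''.div_const 2) hXQ))

end ItoFormula

/-! ### Stieltjes integrals -/

section Stieltjes

variable {P : RefiningGrids} {η F : ℝ → ℝ} {t a b c ε J : ℝ}

instance isFiniteMeasure_variation {Ω : Type*} [MeasurableSpace Ω] (μ : SignedMeasure Ω) :
    IsFiniteMeasure μ.variation := by
  rw [← SignedMeasure.totalVariation_eq_variation, SignedMeasure.totalVariation]
  infer_instance

theorem measureReal_Ioc_sub (μ : Measure ℝ) [IsFiniteMeasure μ] (hab : a ≤ b) (hbc : b ≤ c) :
    μ.real (Ioc a c) - μ.real (Ioc a b) = μ.real (Ioc b c) := by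
  rw [← Ioc_union_Ioc_eq_Ioc hab hbc,
    measureReal_union (Ioc_disjoint_Ioc_of_le le_rfl) measurableSet_Ioc, add_sub_cancel_left]

theorem clamp_mem_Icc (ht : 0 ≤ t) (s : ℝ) : max 0 (min s t) ∈ Icc 0 t :=
  ⟨le_max_left _ _, max_le ht (min_le_right _ _)⟩

theorem stopped_of_mem {s : ℝ} (hs : s ∈ Icc 0 t) : stopped F t s = F s := by
  rw [stopped, min_eq_left hs.2, max_eq_right hs.1]

theorem continuous_stopped (ht : 0 ≤ t) (hF : ContinuousOn F (Icc 0 t)) :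
    Continuous (stopped F t) :=
  hF.comp_continuous (by fun_prop) (clamp_mem_Icc ht)

theorem boundedVariationOn_stopped (ht : 0 ≤ t) (hF : BoundedVariationOn F (Icc 0 t)) :
    BoundedVariationOn (stopped F t) univ :=
  ne_top_of_le_ne_top hF (eVariationOn.comp_le_of_monotoneOn F (fun s => max 0 (min s t))
    (fun _ _ _ _ h => max_le_max le_rfl (min_le_min h le_rfl)) fun s _ => clamp_mem_Icc ht s)

theorem vectorMeasure_Ioc_stopped (hF : ContinuousOn F (Icc 0 t))
    (hBV : BoundedVariationOn (stopped F t) univ) (ha : 0 ≤ a) (hab : a ≤ b) (hb : b ≤ t) :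
    hBV.vectorMeasure (Ioc a b) = F b - F a := by
  have hlim : ∀ s, Function.rightLim (stopped F t) s = stopped F t s := fun s =>
    (continuous_stopped (ha.trans (hab.trans hb)) hF).continuousAt.continuousWithinAt.rightLim_eq
  rw [hBV.vectorMeasure_Ioc hab, hlim, hlim, stopped_of_mem ⟨ha.trans hab, hb⟩,
    stopped_of_mem ⟨ha, hab.trans hb⟩]

theorem integrableOn_vectorMeasure (hη : ContinuousOn η (Icc 0 t))
    (hBV : BoundedVariationOn (stopped F t) univ) (ha : 0 ≤ a) (hb : b ≤ t) :
    hBV.vectorMeasure.IntegrableOn η (Ioc a b) := by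
  have hint : IntegrableOn η (Icc 0 t) hBV.vectorMeasure.variation :=
    hη.integrableOn_compact isCompact_Icc
  rw [VectorMeasure.IntegrableOn, VectorMeasure.Integrable,
    VectorMeasure.variation_restrict measurableSet_Ioc]
  exact hint.mono_set (Ioc_subset_Icc_self.trans (Icc_subset_Icc ha hb))

theorem exists_hasStieltjesIntegral (ht : 0 ≤ t) (hη : ContinuousOn η (Icc 0 t))
    (hF : BoundedVariationOn F (Icc 0 t)) : ∃ J, HasStieltjesIntegral η F t J :=
  ⟨_, boundedVariationOn_stopped ht hF, integrableOn_vectorMeasure hη _ le_rfl le_rfl, rfl⟩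

theorem setIntegral_Ioc_sub (hη : ContinuousOn η (Icc 0 t))
    (hBV : BoundedVariationOn (stopped F t) univ) (ha : 0 ≤ a) (hab : a ≤ b) (hb : b ≤ t) :
    (∫ᵛ s in Ioc 0 b, η s ∂•hBV.vectorMeasure) - ∫ᵛ s in Ioc 0 a, η s ∂•hBV.vectorMeasure =
      ∫ᵛ s in Ioc a b, η s ∂•hBV.vectorMeasure := by
  rw [← Ioc_union_Ioc_eq_Ioc ha hab, VectorMeasure.setIntegral_union
    (Ioc_disjoint_Ioc_of_le le_rfl) measurableSet_Ioc measurableSet_Ioc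
    (integrableOn_vectorMeasure hη hBV le_rfl (hab.trans hb))
    (integrableOn_vectorMeasure hη hBV ha hb), add_sub_cancel_left]

theorem abs_setIntegral_sub_sub_le (hη : ContinuousOn η (Icc 0 t)) (hF : ContinuousOn F (Icc 0 t))
    (hBV : BoundedVariationOn (stopped F t) univ) (ha : 0 ≤ a) (hab : a ≤ b) (hb : b ≤ t)
    (hc : ∀ s ∈ Ioc a b, |η s - c| ≤ ε) :
    |(∫ᵛ s in Ioc 0 b, η s ∂•hBV.vectorMeasure) - (∫ᵛ s in Ioc 0 a, η s ∂•hBV.vectorMeasure) -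
      c * (F b - F a)| ≤ ε * hBV.vectorMeasure.variation.real (Ioc a b) := by
  have hconst : (∫ᵛ _ in Ioc a b, c ∂•hBV.vectorMeasure) = c * (F b - F a) := by
    rw [VectorMeasure.setIntegral_const, vectorMeasure_Ioc_stopped hF hBV ha hab hb]
    simp
  have hint : hBV.vectorMeasure.IntegrableOn (fun _ => c) (Ioc a b) := integrable_const _
  rw [setIntegral_Ioc_sub hη hBV ha hab hb, ← hconst,
    ← VectorMeasure.integral_fun_sub (integrableOn_vectorMeasure hη hBV ha hb) hint]
  refine (VectorMeasure.norm_setIntegral_le_of_norm_le_const (C := ε)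
    (μ := hBV.vectorMeasure) (B := ContinuousLinearMap.lsmul ℝ ℝ)
    (f := fun s => η s - c) hc).trans_eq ?_
  simp

theorem continuousOn_setIntegral_Ioc (hη : ContinuousOn η (Icc 0 t)) (hF : ContinuousOn F (Icc 0 t))
    (hBV : BoundedVariationOn (stopped F t) univ) :
    ContinuousOn (fun s => ∫ᵛ x in Ioc 0 s, η x ∂•hBV.vectorMeasure) (Icc 0 t) := by
  set μ := hBV.vectorMeasure.variation
  set J : ℝ → ℝ := fun s => ∫ᵛ x in Ioc 0 s, η x ∂•hBV.vectorMeasure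
  obtain ⟨K, hK⟩ := isCompact_Icc.exists_bound_of_continuousOn hη
  refine continuousOn_of_forall_le_abs_sub_le fun ε hε => ?_
  obtain ⟨δ, hδ, hηδ⟩ := exists_forall_abs_sub_le isCompact_Icc hη
    (ε := ε / (2 * (μ.real univ + 1))) (by positivity)
  obtain ⟨δ', hδ', hFδ⟩ := exists_forall_abs_sub_le isCompact_Icc hF
    (ε := ε / (2 * (|K| + 1))) (by positivity)
  refine ⟨min δ δ', lt_min hδ hδ', fun u hu v hv huv hlt => ?_⟩
  have hincr : |F v - F u| ≤ ε / (2 * (|K| + 1)) := by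
    refine hFδ v hv u hu ?_
    rw [abs_of_nonneg (sub_nonneg.2 huv)]
    exact hlt.trans_le (min_le_right _ _)
  have hle := abs_setIntegral_sub_sub_le hη hF hBV hu.1 huv hv.2 fun s hs =>
    hηδ s ⟨hu.1.trans hs.1.le, hs.2.trans hv.2⟩ u hu <| by
      rw [abs_of_nonneg (sub_nonneg.2 hs.1.le)]
      linarith [hs.2, min_le_left δ δ']
  calc |J v - J u| ≤ |J v - J u - η u * (F v - F u)| + |η u * (F v - F u)| := by
        simpa using abs_add_le (J v - J u - η u * (F v - F u)) (η u * (F v - F u))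
    _ ≤ ε / (2 * (μ.real univ + 1)) * (μ.real univ + 1) + (|K| + 1) * (ε / (2 * (|K| + 1))) := by
        rw [abs_mul]
        refine add_le_add (hle.trans (mul_le_mul_of_nonneg_left
          ((measureReal_mono (subset_univ _)).trans (lt_add_one _).le) (by positivity))) ?_
        refine mul_le_mul (((hK u hu).trans (le_abs_self K)).trans (lt_add_one _).le) hincr
          (abs_nonneg _) (by positivity)
    _ = ε := by field_simp; norm_num

theorem inc_setIntegral_smodEq (ht : 0 ≤ t) (hη : ContinuousOn η (Icc 0 t))
    (hF : ContinuousOn F (Icc 0 t)) (hBV : BoundedVariationOn (stopped F t) univ) :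
    inc P (fun s => ∫ᵛ x in Ioc 0 s, η x ∂•hBV.vectorMeasure) ≡ val P η * inc P F
      [SMOD nullArrays P t] := by
  set μ := hBV.vectorMeasure.variation
  have hsub : ∀ u v, 0 ≤ u → u ≤ v → μ.real (Ioc 0 v) - μ.real (Ioc 0 u) = μ.real (Ioc u v) :=
    fun u v hu huv => measureReal_Ioc_sub μ hu huv
  have hμ : BoundedVariationOn (fun s => μ.real (Ioc 0 s)) (Icc 0 t) :=
    boundedVariationOn_of_abs_sub_le fun u hu v _ huv => by
      rw [hsub u v hu.1 huv, abs_of_nonneg measureReal_nonneg]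
  refine SModEq.sub_mem.2 (mem_nullArrays_of_le (inc_mem_sumBounded ht hμ) fun ε hε => ?_)
  obtain ⟨δ, hδ, h⟩ := exists_forall_abs_sub_le isCompact_Icc hη hε
  filter_upwards [P.eventually_step_lt hδ] with N hN i hi
  have hi₀ := TimeGrid.pt_mem_Icc hi
  have hi₁ := TimeGrid.pt_succ_mem_Icc hi
  have hle := (P.grid N).pt_le_pt_succ i
  rw [inc, hsub _ _ hi₀.1 hle, abs_of_nonneg measureReal_nonneg]
  refine abs_setIntegral_sub_sub_le hη hF hBV hi₀.1 hle hi₁.2 fun s hs =>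
    h s ⟨hi₀.1.trans hs.1.le, hs.2.trans hi₁.2⟩ _ hi₀ ?_
  rw [abs_of_nonneg (sub_nonneg.2 hs.1.le)]
  linarith [hN i, hs.2]

theorem HasStieltjesIntegral.tendsto_gridSum (ht : 0 ≤ t) (hη : ContinuousOn η (Icc 0 t))
    (hF : ContinuousOn F (Icc 0 t)) (h : HasStieltjesIntegral η F t J) :
    Tendsto (fun N => gridSum P t N (val P η * inc P F)) atTop (𝓝 J) := by
  obtain ⟨hBV, _, rfl⟩ := h
  refine tendsto_gridSum_of_smodEq (inc_setIntegral_smodEq ht hη hF hBV).symm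
    (right_mem_Icc.2 ht) ?_
  simpa using tendsto_gridSum_inc (P := P) ht (continuousOn_setIntegral_Ioc hη hF hBV)

theorem HasContinuousQuadVar.comp {X G G' : ℝ → ℝ} (h : HasContinuousQuadVar P X)
    (hX : ContinuousOn X (Ici 0)) (hG : ∀ s, 0 ≤ s → HasDerivAt G (G' (X s)) (X s))
    (hG' : ContinuousOn (fun s => G' (X s)) (Ici 0)) :
    HasContinuousQuadVar P (fun s => G (X s)) := by
  refine hasContinuousQuadVar_of_smodEq fun t ht => ?_
  have hG't := hG'.mono (Icc_subset_Ici_self (a := t))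
  have hsq := h.sq_inc_smodEq ht.le
  have hBV := boundedVariationOn_stopped ht.le h.boundedVariationOn
  refine ⟨_, continuousOn_setIntegral_Ioc (hG't.pow 2) h.continuousOn hBV, ?_⟩
  refine (sq_inc_comp_smodEq (hX.mono Icc_subset_Ici_self) ?_ (fun s hs => hG s hs.1) hG't).trans
    ((val_mul_smodEq (hG't.pow 2) hsq).trans
      (inc_setIntegral_smodEq ht.le (hG't.pow 2) h.continuousOn hBV).symm)
  exact mem_sumBounded_of_smodEq hsq (inc_mem_sumBounded ht.le h.boundedVariationOn)

end Stieltjes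

/-! ### Stochastic exponentials -/

section StochasticExponential

variable {P : RefiningGrids} {t : ℝ} {e f g : GridArray} {K K' Q R R' X : ℝ → ℝ}

theorem mul_smodEq_of_mem_unifSmall (hg : g ∈ unifSmall P t) (h : e ≡ f [SMOD nullArrays P t]) :
    g * e ≡ g * f [SMOD nullArrays P t] := by
  rw [SModEq.sub_mem] at h ⊢
  rw [← mul_sub]
  exact mul_mem_nullArrays hg h.1

/-- Yor's formula for the product of two stochastic exponentials. -/
theorem inc_mul_smodEq (hK : ContinuousOn K (Icc 0 t)) (hK' : ContinuousOn K' (Icc 0 t))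
    (hR : ContinuousOn R (Icc 0 t))
    (h : inc P K ≡ val P K * inc P R [SMOD nullArrays P t])
    (h' : inc P K' ≡ val P K' * inc P R' [SMOD nullArrays P t]) :
    inc P (fun s => K s * K' s) ≡
      val P (fun s => K s * K' s) * (inc P R + inc P R' + inc P R * inc P R')
      [SMOD nullArrays P t] := by
  have hexp : inc P (fun s => K s * K' s) =
      val P K' * inc P K + val P K * inc P K' + inc P K' * inc P K := by
    ext N i
    simp only [Pi.add_apply, Pi.mul_apply, val, inc]
    ring
  have hcross : inc P K' * inc P K ≡ (val P K * inc P R) * (val P K' * inc P R')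
      [SMOD nullArrays P t] :=
    (mul_smodEq_of_mem_unifSmall (inc_mem_unifSmall hK') h).trans <| by
      rw [mul_comm]
      exact mul_smodEq_of_mem_unifSmall (val_mul_mem_unifSmall hK (inc_mem_unifSmall hR)) h'
  rw [hexp]
  convert ((val_mul_smodEq hK' h).add (val_mul_smodEq hK h')).add hcross using 1
  ext N i
  simp only [Pi.add_apply, Pi.mul_apply, val, inc]
  ring

theorem inc_exp_smodEq (hX : ContinuousOn X (Icc 0 t)) (hQ : inc P Q ∈ sumBounded P t)
    (hXQ : inc P X ^ 2 ≡ inc P Q [SMOD nullArrays P t]) :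
    inc P (fun s => Real.exp (X s)) ≡
      val P (fun s => Real.exp (X s)) * inc P (fun s => X s + Q s / 2) [SMOD nullArrays P t] := by
  convert inc_comp_smodEq hX hQ hXQ (fun _ _ => Real.hasDerivAt_exp _)
    (fun _ _ => Real.hasDerivAt_exp _) hX.rexp using 1
  ext N i
  simp only [Pi.add_apply, Pi.mul_apply, val, inc]
  ring

theorem eq_mul_exp_of_inc_smodEq (ht : 0 ≤ t) (hX : ContinuousOn X (Icc 0 t))
    (hQ : ContinuousOn Q (Icc 0 t)) (hQ' : inc P Q ∈ sumBounded P t)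
    (hXQ : inc P X ^ 2 ≡ inc P Q [SMOD nullArrays P t]) (hK : ContinuousOn K (Icc 0 t))
    (h : inc P K ≡ val P K * inc P (fun s => X s + Q s / 2) [SMOD nullArrays P t]) :
    K t = K 0 * Real.exp (X t - X 0) := by
  have hneg : inc P (fun s => -X s) ^ 2 ≡ inc P Q [SMOD nullArrays P t] := by
    convert hXQ using 1
    ext N i
    simp only [Pi.pow_apply, inc]
    ring
  have hX' : ContinuousOn (fun s => -X s) (Icc 0 t) := hX.neg
  have hR : ContinuousOn (fun s => X s + Q s / 2) (Icc 0 t) := hX.add (hQ.div_const 2)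
  have hprod_cont : ContinuousOn (fun s => K s * Real.exp (-X s)) (Icc 0 t) := hK.mul hX'.rexp
  have hprod := inc_mul_smodEq hK hX'.rexp hR h (inc_exp_smodEq hX' hQ' hneg)
  -- The two drivers add up to `Q`, while their covariation is `-Q`.
  have hdriver : inc P (fun s => X s + Q s / 2) + inc P (fun s => -X s + Q s / 2) +
      inc P (fun s => X s + Q s / 2) * inc P (fun s => -X s + Q s / 2) =
      (inc P Q - inc P X ^ 2) + inc P (fun s => Q s / 4) * inc P Q := by
    ext N i
    simp only [Pi.add_apply, Pi.sub_apply, Pi.mul_apply, Pi.pow_apply, inc]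
    ring
  have hnull : inc P (fun s => K s * Real.exp (-X s)) ∈ nullArrays P t := by
    rw [← SModEq.zero]
    refine hprod.trans (SModEq.zero.2 (val_mul_mem_nullArrays hprod_cont ?_))
    rw [hdriver]
    exact add_mem (SModEq.sub_mem.1 hXQ.symm)
      (mul_mem_nullArrays (inc_mem_unifSmall (hQ.div_const 4)) hQ')
  have hconst := tendsto_nhds_unique (tendsto_gridSum_inc (P := P) ht hprod_cont)
    (hnull.2 t (right_mem_Icc.2 ht))
  rw [sub_eq_neg_add, Real.exp_add, ← mul_assoc, ← sub_eq_zero.1 hconst, mul_assoc,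
    ← Real.exp_add, neg_add_cancel, Real.exp_zero, mul_one]

end StochasticExponential

/-! ### Pathwise Itô integrals of admissible integrands -/

section ItoIntegral

variable {P : RefiningGrids} {t : ℝ} {e f : GridArray} {R X Y Z ξ : ℝ → ℝ}

-- Monotonicity along the nested grids replaces continuity of `R`.
theorem exists_tendsto_gridSum_inc_of_monotoneOn (ht : 0 ≤ t) (hR : MonotoneOn R (Icc 0 t)) :
    ∃ l, Tendsto (fun N => gridSum P t N (inc P R)) atTop (𝓝 l) := by
  have hmem := fun N => (P.grid N).pt_lastIndex_mem_Icc ht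
  simp only [gridSum_inc]
  refine ⟨_, tendsto_atTop_ciSup (fun M N hMN => sub_le_sub_right
    (hR (hmem M) (hmem N) (P.monotone_lastPt ht hMN)) _) ⟨R t - R 0, ?_⟩⟩
  rintro _ ⟨N, rfl⟩
  exact sub_le_sub_right (hR (hmem N) (right_mem_Icc.2 ht) (hmem N).2) _

theorem exists_norm_sub_le_of_boundedVariationOn {ι : Type*} [Fintype ι] {A : ℝ → ι → ℝ}
    (ht : 0 ≤ t) (hA : ∀ k, BoundedVariationOn (fun s => A s k) (Icc 0 t)) :
    ∃ R : ℝ → ℝ, ∀ u ∈ Icc 0 t, ∀ v ∈ Icc 0 t, u ≤ v → ‖A v - A u‖ ≤ R v - R u := by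
  refine ⟨fun s => ∑ k, variationOnFromTo (fun s => A s k) (Icc 0 t) 0 s,
    fun u hu v hv huv => ?_⟩
  have h : ∀ k, |A v k - A u k| ≤ variationOnFromTo (fun s => A s k) (Icc 0 t) 0 v -
      variationOnFromTo (fun s => A s k) (Icc 0 t) 0 u := fun k =>
    variationOnFromTo.abs_sub_le_sub_of_le (hA k).locallyBoundedVariationOn
      (left_mem_Icc.2 ht) hu hv huv
  rw [← Finset.sum_sub_distrib, pi_norm_le_iff_of_nonneg
    (Finset.sum_nonneg fun k _ => (abs_nonneg _).trans (h k))]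
  exact fun k => (h k).trans (Finset.single_le_sum
    (fun k _ => (abs_nonneg _).trans (h k)) (Finset.mem_univ k))

theorem smodEq_inc_of_abs_sub_le (ht : 0 ≤ t)
    (h : ∀ N, ∀ i ∈ (P.grid N).indices t, |e N i - inc P Y N i| ≤ f N i)
    (hf : ∀ s ∈ Icc 0 t, ∃ l, Tendsto (fun N => gridSum P s N f) atTop (𝓝 l))
    (hY : ContinuousOn Y (Icc 0 t)) (hZ : ContinuousOn Z (Icc 0 t))
    (he : ∀ s ∈ Icc 0 t, Tendsto (fun N => gridSum P s N e) atTop (𝓝 (Z s - Z 0))) :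
    e ≡ inc P Z [SMOD nullArrays P t] := by
  choose! W hW using hf
  have hlim : ∀ s ∈ Icc 0 t, Tendsto (fun N => gridSum P s N (e - inc P Y)) atTop
      (𝓝 (Z s - Z 0 - (Y s - Y 0))) := fun s hs => by
    simpa only [map_sub] using (he s hs).sub
      (tendsto_gridSum_inc hs.1 (hY.mono (Icc_subset_Icc_right hs.2)))
  have hBV : BoundedVariationOn (fun s => Z s - Y s) (Icc 0 t) :=
    boundedVariationOn_of_abs_sub_le (R := W) fun u hu v hv huv => by
      have := abs_sub_le_of_tendsto_gridSum huv
        (fun N i hi => h N i ((P.grid N).indices_mono hv.2 hi)) (hlim u hu) (hlim v hv)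
        (hW u hu) (hW v hv)
      convert this using 2
      ring
  have hfb : f ∈ sumBounded P t := mem_sumBounded_of_tendsto_gridSum
    (fun N i hi => (abs_nonneg _).trans (h N i hi)) (hW t (right_mem_Icc.2 ht))
  have heY : e - inc P Y ∈ sumBounded P t := mem_sumBounded_of_le (C := 1) hfb <|
    .of_forall fun N i hi => by
      rw [one_mul]
      exact (h N i hi).trans (le_abs_self _)
  refine smodEq_inc_of_tendsto_gridSum hZ ?_ he
  convert sub_mem heY (inc_mem_sumBounded ht hBV) using 1
  ext N i
  simp only [Pi.sub_apply, inc]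
  ring

theorem abs_integral_sub_integral_sub_mul_le {E : Type*} [SeminormedAddCommGroup E]
    {g : E × ℝ → ℝ} {K : NNReal} {ρ x y : ℝ} {a b : E} (hg : Continuous g)
    (hK : LipschitzOnWith K g (Metric.closedBall 0 ρ)) (ha : ‖a‖ ≤ ρ) (hb : ‖b‖ ≤ ρ)
    (hx : |x| ≤ ρ) (hy : |y| ≤ ρ) :
    |(∫ z in (0 : ℝ)..y, g (b, z)) - (∫ z in (0 : ℝ)..x, g (a, z)) - g (a, x) * (y - x)| ≤
      K * ρ * ‖b - a‖ + K * (y - x) ^ 2 := by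
  have hint : ∀ c u v, IntervalIntegrable (fun z => g (c, z)) volume u v := fun c u v =>
    (show Continuous fun z => g (c, z) by fun_prop).intervalIntegrable u v
  have hmem : ∀ {c : E} {z}, ‖c‖ ≤ ρ → |z| ≤ ρ → (c, z) ∈ Metric.closedBall (0 : E × ℝ) ρ :=
    fun hc hz => mem_closedBall_zero_iff.2 (max_le hc hz)
  have hball : ∀ {u v z : ℝ}, |u| ≤ ρ → |v| ≤ ρ → z ∈ uIoc u v → |z| ≤ ρ := fun hu hv hz =>
    abs_le.2 (uIcc_subset_Icc (abs_le.1 hu) (abs_le.1 hv) (uIoc_subset_uIcc hz))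
  have hfirst : |∫ z in (0 : ℝ)..y, (g (b, z) - g (a, z))| ≤ K * ‖b - a‖ * |y - 0| := by
    refine intervalIntegral.norm_integral_le_of_norm_le_const (E := ℝ) fun z hz => ?_
    have hz' := hball (abs_zero.trans_le ((abs_nonneg y).trans hy)) hy hz
    simpa using hK.norm_sub_le (hmem hb hz') (hmem ha hz')
  have hsecond : |∫ z in x..y, (g (a, z) - g (a, x))| ≤ K * |y - x| * |y - x| := by
    refine intervalIntegral.norm_integral_le_of_norm_le_const (E := ℝ) fun z hz => ?_
    refine (hK.norm_sub_le (hmem ha (hball hx hy hz)) (hmem ha hx)).trans ?_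
    simpa using mul_le_mul_of_nonneg_left (abs_sub_left_of_mem_uIcc (uIoc_subset_uIcc hz)) K.2
  have hsplit : (∫ z in (0 : ℝ)..y, g (b, z)) - (∫ z in (0 : ℝ)..x, g (a, z)) -
      g (a, x) * (y - x) =
      (∫ z in (0 : ℝ)..y, (g (b, z) - g (a, z))) + ∫ z in x..y, (g (a, z) - g (a, x)) := by
    rw [intervalIntegral.integral_sub (hint b 0 y) (hint a 0 y),
      intervalIntegral.integral_sub (hint a x y) intervalIntegrable_const,
      intervalIntegral.integral_const, smul_eq_mul,
      ← intervalIntegral.integral_interval_sub_left (hint a 0 y) (hint a 0 x)]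
    ring
  calc _ ≤ K * ‖b - a‖ * |y - 0| + K * |y - x| * |y - x| :=
        hsplit ▸ (abs_add_le _ _).trans (add_le_add hfirst hsecond)
    _ ≤ K * ‖b - a‖ * ρ + K * (y - x) ^ 2 := by
        rw [sub_zero, mul_assoc _ |y - x|, ← sq, sq_abs]
        gcongr
    _ = K * ρ * ‖b - a‖ + K * (y - x) ^ 2 := by ring

theorem IsAdmissibleIntegrand.exists_abs_val_mul_inc_sub_le (hξ : IsAdmissibleIntegrand X ξ)
    (hX : ContinuousOn X (Ici 0)) (ht : 0 < t) :
    ∃ Y R : ℝ → ℝ, ∃ K : ℝ, ContinuousOn Y (Icc 0 t) ∧ MonotoneOn R (Icc 0 t) ∧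
      ∀ N, ∀ i ∈ (P.grid N).indices t,
        |(val P ξ * inc P X) N i - inc P Y N i| ≤ (inc P R + K • inc P X ^ 2) N i := by
  obtain ⟨n, g, A, hg, hA, hBV, hgξ⟩ := hξ t ht
  have hAX : ContinuousOn (fun s => (A s, X s)) (Icc 0 t) :=
    (hA.prodMk hX).mono Icc_subset_Ici_self
  obtain ⟨R, hR⟩ := exists_norm_sub_le_of_boundedVariationOn ht.le hBV
  obtain ⟨ρ, hρ⟩ := isCompact_Icc.exists_bound_of_continuousOn hAX
  obtain ⟨K, hK⟩ := (hg.contDiffOn (s := Metric.closedBall 0 ρ)).exists_lipschitzOnWith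
    one_ne_zero (convex_closedBall _ _) (isCompact_closedBall _ _)
  have hρ₀ : 0 ≤ ρ := (norm_nonneg _).trans (hρ 0 (left_mem_Icc.2 ht.le))
  have hcont : Continuous fun p : (Fin n → ℝ) × ℝ => ∫ z in (0 : ℝ)..p.2, g (p.1, z) :=
    intervalIntegral.continuous_parametric_intervalIntegral_of_continuous
      (f := fun p z => g (p.1, z)) (by have := hg.continuous; fun_prop) continuous_snd
  refine ⟨fun s => ∫ z in (0 : ℝ)..X s, g (A s, z), fun s => K * ρ * R s, K,
    hcont.comp_continuousOn hAX, fun u hu v hv huv => ?_, fun N i hi => ?_⟩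
  · exact mul_le_mul_of_nonneg_left
      (sub_nonneg.1 ((norm_nonneg _).trans (hR u hu v hv huv))) (by positivity)
  · have hu := TimeGrid.pt_mem_Icc hi
    have hv := TimeGrid.pt_succ_mem_Icc hi
    have hbound := abs_integral_sub_integral_sub_mul_le hg.continuous hK
      ((norm_fst_le _).trans (hρ _ hu)) ((norm_fst_le _).trans (hρ _ hv))
      ((norm_snd_le _).trans (hρ _ hu)) ((norm_snd_le _).trans (hρ _ hv))
    have hvar := mul_le_mul_of_nonneg_left (hR _ hu _ hv ((P.grid N).pt_le_pt_succ i))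
      (show 0 ≤ K * ρ by positivity)
    simp only [Pi.mul_apply, Pi.add_apply, Pi.smul_apply, Pi.pow_apply, val, inc, smul_eq_mul,
      hgξ _ hu, ← mul_sub]
    rw [abs_sub_comm]
    exact hbound.trans (add_le_add_left hvar _)

theorem IsAdmissibleIntegrand.smodEq_inc (hξ : IsAdmissibleIntegrand X ξ)
    (hX : ContinuousOn X (Ici 0)) (hXQ : HasContinuousQuadVar P X) (ht : 0 < t)
    (hZ : ContinuousOn Z (Icc 0 t))
    (hI : ∀ s ∈ Icc 0 t, HasItoIntegral P ξ X s (Z s - Z 0)) :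
    val P ξ * inc P X ≡ inc P Z [SMOD nullArrays P t] := by
  obtain ⟨Y, R, K, hY, hR, h⟩ := hξ.exists_abs_val_mul_inc_sub_le (P := P) hX ht
  refine smodEq_inc_of_abs_sub_le ht.le h (fun s hs => ?_) hY hZ hI
  obtain ⟨l, hl⟩ := exists_tendsto_gridSum_inc_of_monotoneOn (P := P) hs.1
    (hR.mono (Icc_subset_Icc_right hs.2))
  refine ⟨_, (hl.add ((hXQ.tendsto_gridSum hs.1).const_smul K)).congr fun N => ?_⟩
  rw [map_add, map_smul]

theorem IsAdmissibleIntegrand.continuousOn (hξ : IsAdmissibleIntegrand X ξ)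
    (hX : ContinuousOn X (Ici 0)) : ContinuousOn ξ (Icc 0 t) := by
  obtain ⟨n, g, A, hg, hA, -, hgξ⟩ := hξ (max t 1) (by positivity)
  have hcont : ContinuousOn ξ (Icc 0 (max t 1)) :=
    (hg.continuous.comp_continuousOn ((hA.prodMk hX).mono Icc_subset_Ici_self)).congr hgξ
  exact hcont.mono (Icc_subset_Icc_right (le_max_left _ _))

end ItoIntegral

/-! ### Stock, bond and cushion -/

/-- The logarithm `∫₀ᵗ r_s ds` of the bond price. -/
def logBond (r : ℝ → ℝ) (t : ℝ) : ℝ := ∫ s in (0 : ℝ)..t, r s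

/-- The logarithm of the stock price. -/
def logPrice (S : ℝ → ℝ) (t : ℝ) : ℝ := Real.log (S t)

/-- A short rate, integrable on compact intervals of `[0, ∞)`. -/
def IsShortRate (r : ℝ → ℝ) : Prop := ∀ t, 0 < t → IntegrableOn r (Icc 0 t)

/-- A stock price: a continuous positive path with continuous quadratic variation. -/
structure IsPricePath (P : RefiningGrids) (S : ℝ → ℝ) : Prop where
  continuousOn : ContinuousOn S (Ici 0)
  pos : ∀ t, 0 ≤ t → 0 < S t
  hasContinuousQuadVar : HasContinuousQuadVar P S

/-- The finite variation part of the logarithm of the cushion normalised to initial value `1`. -/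
def cushionDrift (P : RefiningGrids) (r S : ℝ → ℝ) (m t : ℝ) : ℝ :=
  (1 - m) * logBond r t - 1 / 2 * m * (m - 1) * quadVar P (logPrice S) t - m * logPrice S 0

/-- The logarithm of the cushion normalised to initial value `1`. -/
def logCushion (P : RefiningGrids) (r S : ℝ → ℝ) (m t : ℝ) : ℝ :=
  m * logPrice S t + cushionDrift P r S m t

/-- The driver `ℓ + ½ [ℓ]` of the cushion, where `ℓ` is its logarithm and `[ℓ] = m² [log S]`. -/
def cushionDriver (P : RefiningGrids) (r S : ℝ → ℝ) (m t : ℝ) : ℝ :=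
  logCushion P r S m t + m ^ 2 * quadVar P (logPrice S) t / 2

section Market

variable {P : RefiningGrids} {r S ξ η K : ℝ → ℝ} {t c m : ℝ}

theorem bond_pos (r : ℝ → ℝ) (t : ℝ) : 0 < bond r t := Real.exp_pos _

theorem logBond_zero (r : ℝ → ℝ) : logBond r 0 = 0 := intervalIntegral.integral_same

theorem bond_zero (r : ℝ → ℝ) : bond r 0 = 1 :=
  (congrArg Real.exp (logBond_zero r)).trans Real.exp_zero

theorem IsShortRate.intervalIntegrable (hr : IsShortRate r) (ht : 0 ≤ t) :
    IntervalIntegrable r volume 0 t :=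
  (intervalIntegrable_iff_integrableOn_Ioc_of_le ht).2 <|
    (hr (t + 1) (by positivity)).mono_set fun _ hs => ⟨hs.1.le, by linarith [hs.2]⟩

theorem abs_logBond_sub_le (hr : IsShortRate r) {u v : ℝ} (hu : 0 ≤ u) (huv : u ≤ v) :
    |logBond r v - logBond r u| ≤ (∫ s in (0 : ℝ)..v, |r s|) - ∫ s in (0 : ℝ)..u, |r s| := by
  have hru := hr.intervalIntegrable hu
  have hrv := hr.intervalIntegrable (hu.trans huv)
  rw [logBond, logBond, intervalIntegral.integral_interval_sub_left hrv hru,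
    intervalIntegral.integral_interval_sub_left hrv.abs hru.abs]
  exact intervalIntegral.abs_integral_le_integral_abs huv

theorem boundedVariationOn_logBond (hr : IsShortRate r) :
    BoundedVariationOn (logBond r) (Icc 0 t) :=
  boundedVariationOn_of_abs_sub_le (R := fun s => ∫ x in (0 : ℝ)..s, |r x|)
    fun _ hu _ _ huv => abs_logBond_sub_le hr hu.1 huv

theorem continuousOn_logBond (hr : IsShortRate r) : ContinuousOn (logBond r) (Ici 0) :=
  continuousOn_Ici_of_Icc fun t ht => by
    have hprim := intervalIntegral.continuousOn_primitive_interval (μ := volume) (f := r) (a := 0)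
      (b := t) (by rw [uIcc_of_le ht.le]; exact hr t ht)
    rwa [uIcc_of_le ht.le] at hprim

theorem continuousOn_bond (hr : IsShortRate r) : ContinuousOn (bond r) (Ici 0) :=
  (continuousOn_logBond hr).rexp

theorem boundedVariationOn_bond (hr : IsShortRate r) : BoundedVariationOn (bond r) (Icc 0 t) := by
  obtain ⟨C, hC⟩ := isCompact_Icc.exists_bound_of_continuousOn
    ((continuousOn_logBond hr).mono (Icc_subset_Ici_self (a := t)))
  obtain ⟨L, hL⟩ := (Real.contDiff_exp.contDiffOn (n := 1)).exists_lipschitzOnWith one_ne_zero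
    (convex_Icc (-C) C) isCompact_Icc
  exact hL.comp_boundedVariationOn (fun s hs => abs_le.1 (hC s hs)) (boundedVariationOn_logBond hr)

theorem inc_bond_smodEq (hr : IsShortRate r) (ht : 0 ≤ t) :
    inc P (bond r) ≡ val P (bond r) * inc P (logBond r) [SMOD nullArrays P t] := by
  have hcont : ContinuousOn (logBond r) (Icc 0 t) :=
    (continuousOn_logBond hr).mono Icc_subset_Ici_self
  have hzero : inc P (fun _ => 0) = 0 := by
    ext N i
    exact sub_self _
  have hsq : inc P (logBond r) ^ 2 ≡ inc P (fun _ => 0) [SMOD nullArrays P t] := by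
    rw [hzero, SModEq.zero, sq]
    exact mul_mem_nullArrays (inc_mem_unifSmall hcont)
      (inc_mem_sumBounded ht (boundedVariationOn_logBond hr))
  simpa using! inc_exp_smodEq hcont (hzero ▸ zero_mem _) hsq

namespace IsPricePath

theorem continuousOn_logPrice (hS : IsPricePath P S) : ContinuousOn (logPrice S) (Ici 0) :=
  hS.continuousOn.log fun s hs => (hS.pos s hs).ne'

theorem hasContinuousQuadVar_logPrice (hS : IsPricePath P S) :
    HasContinuousQuadVar P (logPrice S) :=
  hS.hasContinuousQuadVar.comp hS.continuousOn (fun s hs => Real.hasDerivAt_log (hS.pos s hs).ne')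
    (hS.continuousOn.inv₀ fun s hs => (hS.pos s hs).ne')

theorem inc_smodEq (hS : IsPricePath P S) (ht : 0 ≤ t) :
    inc P S ≡ val P S * inc P (fun s => logPrice S s + quadVar P (logPrice S) s / 2)
      [SMOD nullArrays P t] := by
  have hexp : ∀ N i, Real.exp (logPrice S ((P.grid N).pt i)) = S ((P.grid N).pt i) := fun N i =>
    Real.exp_log (hS.pos _ ((P.grid N).pt_nonneg i))
  have h := inc_exp_smodEq (hS.continuousOn_logPrice.mono Icc_subset_Ici_self)
    (inc_mem_sumBounded ht hS.hasContinuousQuadVar_logPrice.boundedVariationOn)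
    (hS.hasContinuousQuadVar_logPrice.sq_inc_smodEq ht)
  convert h using 1 <;> ext N i <;> simp only [Pi.mul_apply, val, inc, hexp]

end IsPricePath

theorem continuousOn_cushionDrift (hS : IsPricePath P S) (hr : IsShortRate r) (m : ℝ) :
    ContinuousOn (cushionDrift P r S m) (Ici 0) :=
  (((continuousOn_logBond hr).const_mul _).sub (hS.hasContinuousQuadVar_logPrice.2.const_mul _)).sub
    continuousOn_const

theorem boundedVariationOn_cushionDrift (hS : IsPricePath P S) (hr : IsShortRate r) (m : ℝ) :
    BoundedVariationOn (cushionDrift P r S m) (Icc 0 t) := by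
  refine boundedVariationOn_of_abs_sub_le (R := fun s => |1 - m| * (∫ x in (0 : ℝ)..s, |r x|) +
    |1 / 2 * m * (m - 1)| * quadVar P (logPrice S) s) fun u hu v _ huv => ?_
  have hbond := mul_le_mul_of_nonneg_left (abs_logBond_sub_le hr hu.1 huv) (abs_nonneg (1 - m))
  have hquad := mul_le_mul_of_nonneg_left
    (hS.hasContinuousQuadVar_logPrice.abs_quadVar_sub_le hu.1 huv)
    (abs_nonneg (1 / 2 * m * (m - 1)))
  rw [← abs_mul] at hbond hquad
  calc |cushionDrift P r S m v - cushionDrift P r S m u|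
      = |(1 - m) * (logBond r v - logBond r u) -
          1 / 2 * m * (m - 1) * (quadVar P (logPrice S) v - quadVar P (logPrice S) u)| := by
        simp only [cushionDrift]
        ring_nf
    _ ≤ _ := (abs_sub _ _).trans (add_le_add hbond hquad)
    _ = _ := by ring

theorem continuousOn_logCushion (hS : IsPricePath P S) (hr : IsShortRate r) (m : ℝ) :
    ContinuousOn (logCushion P r S m) (Ici 0) :=
  (hS.continuousOn_logPrice.const_mul m).add (continuousOn_cushionDrift hS hr m)

theorem logCushion_zero (P : RefiningGrids) (r S : ℝ → ℝ) (m : ℝ) : logCushion P r S m 0 = 0 := by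
  simp [logCushion, cushionDrift, logBond_zero, quadVar_zero]

theorem sq_inc_logCushion_smodEq (hS : IsPricePath P S) (hr : IsShortRate r) (ht : 0 ≤ t) :
    inc P (logCushion P r S m) ^ 2 ≡ inc P (fun s => m ^ 2 * quadVar P (logPrice S) s)
      [SMOD nullArrays P t] := by
  set D := cushionDrift P r S m
  have hDs : inc P D ∈ unifSmall P t :=
    inc_mem_unifSmall ((continuousOn_cushionDrift hS hr m).mono Icc_subset_Ici_self)
  have hLs : inc P (logPrice S) ∈ unifSmall P t :=
    inc_mem_unifSmall (hS.continuousOn_logPrice.mono Icc_subset_Ici_self)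
  have hcross : ((2 * m) • inc P (logPrice S) + inc P D) * inc P D ∈ nullArrays P t :=
    mul_mem_nullArrays (add_mem (Submodule.smul_mem _ _ hLs) hDs)
      (inc_mem_sumBounded ht (boundedVariationOn_cushionDrift hS hr m))
  have h := ((hS.hasContinuousQuadVar_logPrice.sq_inc_smodEq ht).smul (m ^ 2)).add
    (SModEq.zero.2 hcross)
  convert h using 1 <;> ext N i <;>
    simp only [Pi.add_apply, Pi.smul_apply, Pi.mul_apply, Pi.pow_apply, Pi.zero_apply, inc,
      smul_eq_mul, logCushion, D] <;> ring

theorem smodEq_cushion_of_stock_bond (hS : IsPricePath P S) (hr : IsShortRate r) (ht : 0 ≤ t)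
    (hK : ContinuousOn K (Icc 0 t)) (hξ : ∀ s, 0 ≤ s → ξ s = m * K s / S s)
    (hη : ∀ s, 0 ≤ s → η s = ((1 - m) * K s + c * bond r s) / bond r s) :
    val P ξ * inc P S + val P η * inc P (bond r) ≡
      val P K * inc P (cushionDriver P r S m) + c • inc P (bond r) [SMOD nullArrays P t] := by
  have hSt := hS.continuousOn.mono (Icc_subset_Ici_self (a := t))
  have hBt := (continuousOn_bond hr).mono (Icc_subset_Ici_self (a := t))
  have hstock : ContinuousOn (fun s => m * K s / S s) (Icc 0 t) :=
    (hK.const_mul m).div hSt fun s hs => (hS.pos s hs.1).ne'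
  have hbond : ContinuousOn (fun s => (1 - m) * K s / bond r s) (Icc 0 t) :=
    (hK.const_mul _).div hBt fun s _ => (bond_pos r s).ne'
  have h := ((val_mul_smodEq hstock (hS.inc_smodEq ht)).add
    (val_mul_smodEq hbond (inc_bond_smodEq hr ht))).add
    (SModEq.rfl (x := c • inc P (bond r)))
  convert h using 1 <;> ext N i <;>
  · have hpt := (P.grid N).pt_nonneg i
    have hS₀ := (hS.pos _ hpt).ne'
    have hB₀ := (bond_pos r ((P.grid N).pt i)).ne'
    simp only [Pi.add_apply, Pi.smul_apply, Pi.mul_apply, val, inc, smul_eq_mul, hξ _ hpt,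
      hη _ hpt, cushionDriver, logCushion, cushionDrift]
    field_simp
    ring

end Market

/-! ### The CPPI strategy is self-financing -/

section Existence

variable {P : RefiningGrids} {r S : ℝ → ℝ} {V₀ α m t : ℝ}

theorem cppiCushion_eq (hS : IsPricePath P S) (ht : 0 ≤ t) :
    cppiCushion P r S V₀ α m t = (1 - α) * V₀ * Real.exp (logCushion P r S m t) := by
  have hS₀ := hS.pos 0 le_rfl
  have hSt := hS.pos t ht
  rw [cppiCushion, Real.rpow_def_of_pos (div_pos hSt hS₀), bond, ← Real.exp_mul,
    mul_assoc, mul_assoc, ← Real.exp_add, ← Real.exp_add, Real.log_div hSt.ne' hS₀.ne']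
  congr 2
  change _ + (_ + -(1 / 2) * m * (m - 1) * quadVar P (logPrice S) t) = _
  simp only [logCushion, cushionDrift, logBond, logPrice]
  ring

theorem cppiCushion_zero (hS : IsPricePath P S) : cppiCushion P r S V₀ α m 0 = (1 - α) * V₀ := by
  rw [cppiCushion_eq hS le_rfl, logCushion_zero, Real.exp_zero, mul_one]

theorem continuousOn_cppiCushion (hS : IsPricePath P S) (hr : IsShortRate r) :
    ContinuousOn (cppiCushion P r S V₀ α m) (Ici 0) :=
  ((continuousOn_logCushion hS hr m).rexp.const_mul ((1 - α) * V₀)).congr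
    fun _ hs => cppiCushion_eq hS hs

theorem continuousOn_cppiValue (hS : IsPricePath P S) (hr : IsShortRate r) :
    ContinuousOn (cppiValue P r S V₀ α m) (Ici 0) :=
  (continuousOn_cppiCushion hS hr).add ((continuousOn_bond hr).const_mul _)

theorem continuousOn_cppiStock (hS : IsPricePath P S) (hr : IsShortRate r) :
    ContinuousOn (cppiStock P r S V₀ α m) (Ici 0) :=
  ((continuousOn_cppiCushion hS hr).const_mul m).div hS.continuousOn
    fun s hs => (hS.pos s hs).ne'

theorem continuousOn_cppiBond (hS : IsPricePath P S) (hr : IsShortRate r) :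
    ContinuousOn (cppiBond P r S V₀ α m) (Ici 0) :=
  ((continuousOn_cppiValue hS hr).sub ((continuousOn_cppiCushion hS hr).const_mul m)).div
    (continuousOn_bond hr) fun s _ => (bond_pos r s).ne'

theorem portfolioValue_cppi (hS : IsPricePath P S) (ht : 0 ≤ t) :
    portfolioValue r S (cppiStock P r S V₀ α m) (cppiBond P r S V₀ α m) t =
      cppiValue P r S V₀ α m t := by
  rw [portfolioValue, cppiStock, cppiBond, div_mul_cancel₀ _ (hS.pos t ht).ne',
    div_mul_cancel₀ _ (bond_pos r t).ne', add_sub_cancel]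

theorem followsCPPI_cppi (hS : IsPricePath P S) :
    FollowsCPPI r S V₀ α m (cppiStock P r S V₀ α m) (cppiBond P r S V₀ α m) where
  initial := by
    rw [portfolioValue_cppi hS le_rfl, cppiValue, cppiCushion_zero hS, bond_zero]
    ring
  stock_eq t ht := by
    rw [portfolioValue_cppi hS ht, cppiValue, add_sub_cancel_right, cppiStock]
  bond_eq t ht := by
    rw [portfolioValue_cppi hS ht, cppiStock, cppiBond, div_mul_cancel₀ _ (hS.pos t ht).ne']
  bond_eq' t ht := by
    rw [portfolioValue_cppi hS ht, cppiBond, cppiValue, add_sub_cancel_right]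

theorem le_cppiValue (hS : IsPricePath P S) (h : 0 ≤ (1 - α) * V₀) (ht : 0 ≤ t) :
    α * V₀ * bond r t ≤ cppiValue P r S V₀ α m t := by
  rw [cppiValue, cppiCushion_eq hS ht]
  exact le_add_of_nonneg_left (mul_nonneg h (Real.exp_pos _).le)

theorem inc_cppiCushion_smodEq (hS : IsPricePath P S) (hr : IsShortRate r) (ht : 0 ≤ t) :
    inc P (cppiCushion P r S V₀ α m) ≡
      val P (cppiCushion P r S V₀ α m) * inc P (cushionDriver P r S m) [SMOD nullArrays P t] := by
  have h := (inc_exp_smodEq ((continuousOn_logCushion hS hr m).mono Icc_subset_Ici_self)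
    (hS.hasContinuousQuadVar_logPrice.inc_const_mul_mem_sumBounded ht (m ^ 2))
    (sq_inc_logCushion_smodEq hS hr ht)).smul ((1 - α) * V₀)
  convert h using 1 <;> ext N i <;>
  · simp only [Pi.smul_apply, Pi.mul_apply, smul_eq_mul, val, inc, cushionDriver,
      cppiCushion_eq hS ((P.grid N).pt_nonneg _)]
    ring

theorem inc_cppiValue_smodEq (hS : IsPricePath P S) (hr : IsShortRate r) (ht : 0 ≤ t) :
    val P (cppiStock P r S V₀ α m) * inc P S + val P (cppiBond P r S V₀ α m) * inc P (bond r) ≡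
      inc P (cppiValue P r S V₀ α m) [SMOD nullArrays P t] := by
  have h := (smodEq_cushion_of_stock_bond (P := P) (m := m) (K := cppiCushion P r S V₀ α m)
    (ξ := cppiStock P r S V₀ α m) (η := cppiBond P r S V₀ α m) (c := α * V₀) hS hr ht
    ((continuousOn_cppiCushion hS hr).mono Icc_subset_Ici_self) (fun _ _ => rfl)
    (fun s _ => show cppiBond P r S V₀ α m s = _ by rw [cppiBond, cppiValue]; ring)).trans
    ((inc_cppiCushion_smodEq hS hr ht).symm.add SModEq.rfl)
  convert h using 1
  ext N i
  simp only [Pi.add_apply, Pi.smul_apply, smul_eq_mul, inc, cppiValue]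
  ring

theorem exists_contDiff_pos_eq_id {δ : ℝ} (hδ : 0 < δ) :
    ∃ τ : ℝ → ℝ, ContDiff ℝ 1 τ ∧ (∀ x, 0 < τ x) ∧ ∀ x, δ ≤ x → τ x = x := by
  have hδ' := half_pos hδ
  refine ⟨fun x => δ / 2 + Real.smoothTransition ((x - δ / 2) / (δ / 2)) * (x - δ / 2),
    ?_, fun x => ?_, fun x hx => ?_⟩
  · have h : ContDiff ℝ 1 fun x : ℝ => (x - δ / 2) / (δ / 2) := by fun_prop
    exact contDiff_const.add ((Real.smoothTransition.contDiff.comp h).mul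
      (contDiff_id.sub contDiff_const))
  · refine add_pos_of_pos_of_nonneg hδ' ?_
    rcases le_total x (δ / 2) with h | h
    · rw [Real.smoothTransition.zero_of_nonpos
        (div_nonpos_of_nonpos_of_nonneg (sub_nonpos.2 h) hδ'.le), zero_mul]
    · exact mul_nonneg (Real.smoothTransition.nonneg _) (sub_nonneg.2 h)
  · change δ / 2 + Real.smoothTransition ((x - δ / 2) / (δ / 2)) * (x - δ / 2) = x
    rw [Real.smoothTransition.one_of_one_le ((one_le_div hδ').2 (by linarith)), one_mul,
      add_sub_cancel]

-- The logarithm and the quotient are not smooth at `0`, so the stock price is first passed through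
-- a positive smooth function that is the identity above the minimum of `S` on `[0, T]`.
theorem isAdmissibleIntegrand_cppiStock (hS : IsPricePath P S) (hr : IsShortRate r) :
    IsAdmissibleIntegrand S (cppiStock P r S V₀ α m) := by
  intro T hT
  obtain ⟨x, hx, hmin⟩ := isCompact_Icc.exists_isMinOn (nonempty_Icc.2 hT.le)
    (hS.continuousOn.mono (Icc_subset_Ici_self (a := T)))
  obtain ⟨τ, hτ, hτ_pos, hτ_eq⟩ := exists_contDiff_pos_eq_id (hS.pos x hx.1)
  refine ⟨1, fun p => m * ((1 - α) * V₀ * Real.exp (m * Real.log (τ p.2) + p.1 0)) / τ p.2,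
    fun s _ => cushionDrift P r S m s, ?_, ?_, ?_, fun s hs => ?_⟩
  · have hprice : ContDiff ℝ 1 fun p : (Fin 1 → ℝ) × ℝ => τ p.2 := hτ.comp contDiff_snd
    have hdrift : ContDiff ℝ 1 fun p : (Fin 1 → ℝ) × ℝ => p.1 0 := by fun_prop
    exact (contDiff_const.mul (contDiff_const.mul
      ((contDiff_const.mul (hprice.log fun p => (hτ_pos _).ne')).add hdrift).exp)).div hprice
      fun p => (hτ_pos _).ne'
  · exact continuousOn_pi.2 fun _ => continuousOn_cushionDrift hS hr m
  · exact fun _ => boundedVariationOn_cushionDrift hS hr m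
  · simp only [cppiStock, cppiCushion_eq hS hs.1, hτ_eq _ (hmin hs), logCushion, logPrice]

theorem exists_integrals_cppi (hS : IsPricePath P S) (hr : IsShortRate r) (ht : 0 ≤ t) :
    ∃ I J, HasItoIntegral P (cppiStock P r S V₀ α m) S t I ∧
      HasStieltjesIntegral (cppiBond P r S V₀ α m) (bond r) t J ∧
      cppiValue P r S V₀ α m t = cppiValue P r S V₀ α m 0 + I + J := by
  have hη := (continuousOn_cppiBond (V₀ := V₀) (α := α) (m := m) hS hr).mono
    (Icc_subset_Ici_self (a := t))
  have hB := (continuousOn_bond hr).mono (Icc_subset_Ici_self (a := t))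
  have hV := (continuousOn_cppiValue (V₀ := V₀) (α := α) (m := m) hS hr).mono
    (Icc_subset_Ici_self (a := t))
  obtain ⟨J, hJ⟩ := exists_hasStieltjesIntegral ht hη (boundedVariationOn_bond hr)
  refine ⟨cppiValue P r S V₀ α m t - cppiValue P r S V₀ α m 0 - J, J, ?_, hJ, by ring⟩
  have h := (tendsto_gridSum_of_smodEq (inc_cppiValue_smodEq hS hr ht) (right_mem_Icc.2 ht)
    (tendsto_gridSum_inc ht hV)).sub (hJ.tendsto_gridSum (P := P) ht hη hB)
  simp only [← map_sub, add_sub_cancel_right] at h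
  exact h

theorem isSelfFinancing_cppi (hS : IsPricePath P S) (hr : IsShortRate r) :
    IsSelfFinancing P r S (cppiStock P r S V₀ α m) (cppiBond P r S V₀ α m) where
  measurable_stock :=
    (continuousOn_iff_continuous_domRestrict.1 (continuousOn_cppiStock hS hr)).measurable
  measurable_bond :=
    (continuousOn_iff_continuous_domRestrict.1 (continuousOn_cppiBond hS hr)).measurable
  admissible := isAdmissibleIntegrand_cppiStock hS hr
  integrable t ht :=
    have hrt : IntegrableOn r (Icc 0 t) :=
      (hr (t + 1) (by positivity)).mono_set (Icc_subset_Icc_right (lt_add_one t).le)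
    hrt.continuousOn_mul ((continuousOn_cppiBond hS hr).mono Icc_subset_Ici_self) isCompact_Icc
  value_eq t ht := by
    rw [portfolioValue_cppi hS ht, portfolioValue_cppi hS le_rfl]
    exact exists_integrals_cppi hS hr ht

end Existence

/-! ### Uniqueness -/

section Uniqueness

variable {P : RefiningGrids} {r S ξ η : ℝ → ℝ} {V₀ α m t : ℝ}

theorem IsSelfFinancing.smodEq_inc (h : IsSelfFinancing P r S ξ η) (hS : IsPricePath P S)
    (hr : IsShortRate r) (hη : ContinuousOn η (Icc 0 t)) (ht : 0 < t) :
    val P ξ * inc P S + val P η * inc P (bond r) ≡ inc P (portfolioValue r S ξ η)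
      [SMOD nullArrays P t] := by
  have hB := (continuousOn_bond hr).mono (Icc_subset_Ici_self (a := t))
  have hBV := boundedVariationOn_stopped ht.le (boundedVariationOn_bond (t := t) hr)
  set V := portfolioValue r S ξ η
  have hV : ContinuousOn V (Icc 0 t) := ((h.admissible.continuousOn hS.continuousOn).mul
    (hS.continuousOn.mono Icc_subset_Ici_self)).add (hη.mul hB)
  set J : ℝ → ℝ := fun s => ∫ᵛ x in Ioc 0 s, η x ∂•hBV.vectorMeasure
  have hJ : ContinuousOn J (Icc 0 t) := continuousOn_setIntegral_Ioc hη hB hBV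
  have hJη : inc P J ≡ val P η * inc P (bond r) [SMOD nullArrays P t] :=
    inc_setIntegral_smodEq ht.le hη hB hBV
  have hIto : ∀ s ∈ Icc 0 t, HasItoIntegral P ξ S s ((V s - J s) - (V 0 - J 0)) := fun s hs => by
    obtain ⟨I, J', hI, hJ', hval⟩ := h.value_eq s hs.1
    have hsub : Icc 0 s ⊆ Icc 0 t := Icc_subset_Icc_right hs.2
    have hJs : J' = J s - J 0 := tendsto_nhds_unique
      (hJ'.tendsto_gridSum (P := P) hs.1 (hη.mono hsub) (hB.mono hsub))
      (tendsto_gridSum_of_smodEq hJη.symm hs (tendsto_gridSum_inc hs.1 (hJ.mono hsub)))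
    convert hI using 1
    linarith
  have hstock := h.admissible.smodEq_inc hS.continuousOn hS.hasContinuousQuadVar ht (hV.sub hJ) hIto
  convert hstock.add hJη.symm using 1
  ext N i
  simp only [Pi.add_apply, Pi.sub_apply, inc]
  ring

/-- The cushion `V_t - α V₀ B_t` of an arbitrary strategy `(ξ, η)`, the part of its value in excess
of the floor. -/
def cushion (r S ξ η : ℝ → ℝ) (V₀ α t : ℝ) : ℝ := portfolioValue r S ξ η t - α * V₀ * bond r t

namespace FollowsCPPI

theorem stock_eq_cushion (h : FollowsCPPI r S V₀ α m ξ η) (ht : 0 ≤ t) :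
    ξ t = m * cushion r S ξ η V₀ α t / S t := h.stock_eq t ht

theorem bond_eq_cushion (h : FollowsCPPI r S V₀ α m ξ η) (ht : 0 ≤ t) :
    η t = ((1 - m) * cushion r S ξ η V₀ α t + α * V₀ * bond r t) / bond r t := by
  rw [h.bond_eq' t ht, cushion]
  ring

theorem cushion_zero (h : FollowsCPPI r S V₀ α m ξ η) :
    cushion r S ξ η V₀ α 0 = (1 - α) * V₀ := by
  rw [cushion, h.initial, bond_zero]
  ring

theorem continuousOn_cushion (h : FollowsCPPI r S V₀ α m ξ η) (hS : IsPricePath P S) (hm : m ≠ 0)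
    (hξ : IsAdmissibleIntegrand S ξ) : ContinuousOn (cushion r S ξ η V₀ α) (Icc 0 t) := by
  refine (((hξ.continuousOn hS.continuousOn).mul
    (hS.continuousOn.mono Icc_subset_Ici_self)).div_const m).congr fun s hs => ?_
  change cushion r S ξ η V₀ α s = ξ s * S s / m
  rw [h.stock_eq_cushion hs.1, div_mul_cancel₀ _ (hS.pos s hs.1).ne', mul_div_cancel_left₀ _ hm]

theorem continuousOn_bondHolding (h : FollowsCPPI r S V₀ α m ξ η) (hr : IsShortRate r)
    (hK : ContinuousOn (cushion r S ξ η V₀ α) (Icc 0 t)) : ContinuousOn η (Icc 0 t) := by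
  have hB := (continuousOn_bond hr).mono (Icc_subset_Ici_self (a := t))
  exact (((hK.const_mul (1 - m)).add (hB.const_mul (α * V₀))).div hB
    fun s _ => (bond_pos r s).ne').congr fun s hs => h.bond_eq_cushion hs.1

theorem inc_cushion_smodEq (h : FollowsCPPI r S V₀ α m ξ η) (hsf : IsSelfFinancing P r S ξ η)
    (hS : IsPricePath P S) (hr : IsShortRate r) (hm : m ≠ 0) (ht : 0 < t) :
    inc P (cushion r S ξ η V₀ α) ≡
      val P (cushion r S ξ η V₀ α) * inc P (cushionDriver P r S m) [SMOD nullArrays P t] := by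
  have hK := h.continuousOn_cushion (t := t) hS hm hsf.admissible
  have hvalue := (hsf.smodEq_inc hS hr (h.continuousOn_bondHolding hr hK) ht).symm.trans
    (smodEq_cushion_of_stock_bond hS hr ht.le hK (fun _ => h.stock_eq_cushion)
      fun _ => h.bond_eq_cushion)
  convert hvalue.sub (SModEq.rfl (x := (α * V₀) • inc P (bond r))) using 1
  · ext N i
    simp only [Pi.sub_apply, Pi.smul_apply, smul_eq_mul, inc, cushion]
    ring
  · rw [add_sub_cancel_right]

theorem cushion_eq_cppiCushion (h : FollowsCPPI r S V₀ α m ξ η) (hsf : IsSelfFinancing P r S ξ η)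
    (hS : IsPricePath P S) (hr : IsShortRate r) (hm : m ≠ 0) (ht : 0 ≤ t) :
    cushion r S ξ η V₀ α t = cppiCushion P r S V₀ α m t := by
  rcases ht.eq_or_lt with rfl | ht
  · rw [h.cushion_zero, cppiCushion_zero hS]
  have hQ := hS.hasContinuousQuadVar_logPrice
  have hsol := eq_mul_exp_of_inc_smodEq ht.le
    ((continuousOn_logCushion hS hr m).mono Icc_subset_Ici_self) (hQ.continuousOn.const_mul (m ^ 2))
    (hQ.inc_const_mul_mem_sumBounded ht.le (m ^ 2)) (sq_inc_logCushion_smodEq hS hr ht.le)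
    (h.continuousOn_cushion hS hm hsf.admissible) (h.inc_cushion_smodEq hsf hS hr hm ht)
  rw [hsol, h.cushion_zero, logCushion_zero, sub_zero, cppiCushion_eq hS ht.le]

theorem eq_cppi (h : FollowsCPPI r S V₀ α m ξ η) (hsf : IsSelfFinancing P r S ξ η)
    (hS : IsPricePath P S) (hr : IsShortRate r) (hm : m ≠ 0) (ht : 0 ≤ t) :
    ξ t = cppiStock P r S V₀ α m t ∧ η t = cppiBond P r S V₀ α m t := by
  have hK := h.cushion_eq_cppiCushion hsf hS hr hm ht
  refine ⟨by rw [h.stock_eq_cushion ht, hK, cppiStock], ?_⟩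
  rw [h.bond_eq_cushion ht, hK, cppiBond, cppiValue]
  ring

end FollowsCPPI

end Uniqueness

end PathwiseCPPI

end

open PathwiseCPPI in
theorem theorem2_general (P : RefiningGrids) (r S : ℝ → ℝ)
    (hr : ∀ t : ℝ, 0 < t → IntegrableOn r (Icc 0 t))
    (hS_cont : ContinuousOn S (Ici 0)) (hS_pos : ∀ t : ℝ, 0 ≤ t → 0 < S t)
    (hS_qv : HasContinuousQuadVar P S)
    (V₀ α m : ℝ) (h : 0 ≤ (1 - α) * V₀) (hm : m ≠ 0) :
    HasContinuousQuadVar P (fun t => Real.log (S t)) ∧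
    IsSelfFinancing P r S (cppiStock P r S V₀ α m) (cppiBond P r S V₀ α m) ∧
    (∀ t : ℝ, 0 ≤ t →
      portfolioValue r S (cppiStock P r S V₀ α m) (cppiBond P r S V₀ α m) t
        = cppiValue P r S V₀ α m t) ∧
    FollowsCPPI r S V₀ α m (cppiStock P r S V₀ α m) (cppiBond P r S V₀ α m) ∧
    (∀ t : ℝ, 0 ≤ t → α * V₀ * bond r t ≤ cppiValue P r S V₀ α m t) ∧
    (∀ ξ η : ℝ → ℝ, IsSelfFinancing P r S ξ η → FollowsCPPI r S V₀ α m ξ η →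
      ∀ t : ℝ, 0 ≤ t → ξ t = cppiStock P r S V₀ α m t ∧ η t = cppiBond P r S V₀ α m t) := by
  have hS : IsPricePath P S := ⟨hS_cont, hS_pos, hS_qv⟩
  exact ⟨hS.hasContinuousQuadVar_logPrice, isSelfFinancing_cppi hS hr,
    fun _ => portfolioValue_cppi hS, followsCPPI_cppi hS, fun _ => le_cppiValue hS h,
    fun _ _ hsf hcppi _ => hcppi.eq_cppi hsf hS hr hm⟩

open PathwiseCPPI in
theorem theorem2 (P : RefiningGrids) (r S : ℝ → ℝ)
    (hr : ∀ t : ℝ, 0 < t → IntegrableOn r (Icc 0 t))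
    (hS_cont : ContinuousOn S (Ici 0)) (hS_pos : ∀ t : ℝ, 0 ≤ t → 0 < S t)
    (hS_qv : HasContinuousQuadVar P S)
    (V₀ α m : ℝ) (hV₀ : 0 ≤ V₀) (hα : α ∈ Icc (0 : ℝ) 1) (hm : 0 < m) :
    HasContinuousQuadVar P (fun t => Real.log (S t)) ∧
    IsSelfFinancing P r S (cppiStock P r S V₀ α m) (cppiBond P r S V₀ α m) ∧
    (∀ t : ℝ, 0 ≤ t →
      portfolioValue r S (cppiStock P r S V₀ α m) (cppiBond P r S V₀ α m) t
        = cppiValue P r S V₀ α m t) ∧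
    FollowsCPPI r S V₀ α m (cppiStock P r S V₀ α m) (cppiBond P r S V₀ α m) ∧
    (∀ t : ℝ, 0 ≤ t → α * V₀ * bond r t ≤ cppiValue P r S V₀ α m t) ∧
    (∀ ξ η : ℝ → ℝ, IsSelfFinancing P r S ξ η → FollowsCPPI r S V₀ α m ξ η →
      ∀ t : ℝ, 0 ≤ t → ξ t = cppiStock P r S V₀ α m t ∧ η t = cppiBond P r S V₀ α m t) :=
  theorem2_general P r S hr hS_cont hS_pos hS_qv V₀ α m (mul_nonneg (sub_nonneg.2 hα.2) hV₀) hm.ne'
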